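/- **Setting.** Let $\mathbb S^1\subset\mathbb R^2$ be the unit circle with arc-length measure $d\omega$ (total mass $2\pi$), and let $\nabla$, $\Delta$ be the gradient and the Laplace–Beltrami operator on $\mathbb S^1$. For a probability measure $\rho$ on $\mathbb S^1$ put $$J_\rho=\int_{\mathbb S^1}\omega\,d\rho(\omega)\in\mathbb R^2,\qquad \Omega_\rho=\frac{J_\rho}{|J_\rho|}\quad(J_\rho\neq 0;\ \text{we set }\Omega_\rho=0\text{ if }J_\rho=0),$$ and let $M_\Omega(\omega)=C_M e^{\omega\cdot\Omega}$ with $C_M=\big(\int_{\mathbb S^1}e^{\omega\cdot\Omega}\,d\omega\big)^{-1}$. For positive $C^1$ probability densities $f,g$ on $\mathbb S^1$ let $$I(f\,|\,g)=\int_{\mathbb S^1}\Big|\nabla\log\frac{f}{g}\Big|^2 f\,d\omega .$$ A weak solution of the Vicsek equation $$\partial_t\rho=\Delta\rho-\nabla\cdot\big(\rho\,\mathbb P_{\omega^\perp}\Omega_\rho\big)\ \text{ on }\ \mathbb S^1,\qquad \mathbb P_{\omega^\perp}=\mathrm{Id}-\omega\otimes\omega,$$ starting from a probability measure $\rho_0$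 is a weakly continuous curve $(\rho_t)_{t\ge0}$ of probability measures on $\mathbb S^1$, with the given $\rho_0$ at $t=0$, which belongs to $L^2_{loc}([0,\infty),W^{1,1}(\mathbb S^1))$ and satisfies, for all $\psi\in C^\infty(\mathbb S^1)$ and $t\ge0$, $$\int_{\mathbb S^1}\psi\,d\rho_t=\int_{\mathbb S^1}\psi\,d\rho_0+\int_0^t\int_{\mathbb S^1}\big(\Delta\psi+\mathbb P_{\omega^\perp}\Omega_{\rho_r}\cdot\nabla\psi\big)\,d\rho_r\,dr .$$ **Lemma.** Let $\rho_0$ be a probability measure on $\mathbb S^1$ with a density, also denoted $\rho_0$, such that $$\rho_0>0\ \text{ a.e.},\qquad |J_{\rho_0}|>0,\qquad \int_{\mathbb S^1}\rho_0\log\rho_0\,d\omega<\infty,$$ and let $(\rho_t)_{t\ge0}$ be a weak solution starting from $\rho_0$. Then for every $t>0$ the measure $\rho_t$ has a strictly positive density of class $C^\infty(\mathbb S^1)$, again denoted $\rho_t$, and for all $t\ge s>0$ the minimum $\min_{r\in[s,t]}|J_{\rho_r}|$ is attained and positive, and $$I(\rho_t\,|\,M_{\Omega_{\rho_t}})\le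 I(\rho_s\,|\,M_{\Omega_{\rho_s}})\,\exp\!\bigg(\Big(2+\frac{2}{\min_{r\in[s,t]}|J_{\rho_r}|}\Big)(t-s)\bigg).$$ -/

import Mathlib

open Set MeasureTheory
open scoped Real InnerProductSpace

noncomputable section

namespace Vicsek

/-! The unit circle `S¹` is Mathlib's `Circle`, the unit circle of the plane `ℂ = ℝ²`. The plane
carries its Euclidean inner product `⟪z, w⟫_ℝ` and norm `‖z‖`. -/

/-- The Borel `σ`-algebra of the circle. -/
instance instMeasurableSpaceCircle : MeasurableSpace Circle := borel Circle

instance instBorelSpaceCircle : BorelSpace Circle := ⟨rfl⟩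

/-- The arc-length measure `dω` on the unit circle (of total mass `2π`). -/
def arcLength : Measure Circle :=
  (volume.restrict (Ioc (-π) π)).map Circle.exp

/-- `f` is a `C^∞` function on the circle: its `2π`-periodic lift in the angle is `C^∞`. -/
def IsSmooth (f : Circle → ℝ) : Prop :=
  ContDiff ℝ (⊤ : ℕ∞) (fun θ : ℝ => f (Circle.exp θ))

/-- The derivative of `f` at `ω` with respect to (counterclockwise) arc length. -/
def arcDeriv (f : Circle → ℝ) (ω : Circle) : ℝ :=
  deriv (fun θ : ℝ => f (ω * Circle.exp θ)) 0

/-- The gradient `∇f(ω)` on the circle, a vector of the plane tangent to the circle at `ω`. Here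
`i ω` is the counterclockwise unit tangent vector at `ω`. -/
def grad (f : Circle → ℝ) (ω : Circle) : ℂ :=
  arcDeriv f ω • (Complex.I * (ω : ℂ))

/-- The Laplace-Beltrami operator of the circle. -/
def laplacian (f : Circle → ℝ) (ω : Circle) : ℝ :=
  arcDeriv (arcDeriv f) ω

/-- The orthogonal projection `P_{ω^⊥} v = (Id - ω ⊗ ω) v`. -/
def projPerp (ω : Circle) (v : ℂ) : ℂ :=
  v - ⟪(ω : ℂ), v⟫_ℝ • (ω : ℂ)

/-- The flux `J_ρ = ∫ ω dρ(ω)`. -/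
def flux (ρ : ProbabilityMeasure Circle) : ℂ :=
  ∫ ω : Circle, (ω : ℂ) ∂(ρ : Measure Circle)

/-- The mean direction `Ω_ρ = J_ρ / |J_ρ|`. -/
def direction (ρ : ProbabilityMeasure Circle) : ℂ :=
  ‖flux ρ‖⁻¹ • flux ρ

/-- `ρ` is the measure `f dω`, with `f` a nonnegative density. -/
def HasDensity (ρ : ProbabilityMeasure Circle) (f : Circle → ℝ) : Prop :=
  (∀ᵐ ω ∂arcLength, 0 ≤ f ω) ∧
    (ρ : Measure Circle) = arcLength.withDensity (fun ω => ENNReal.ofReal (f ω))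

/-- `f` belongs to the Sobolev space `W^{1,1}` of the circle, with weak derivative `g`. -/
def HasWeakDerivL1 (f g : Circle → ℝ) : Prop :=
  Integrable f arcLength ∧ Integrable g arcLength ∧
    ∀ ψ : Circle → ℝ, IsSmooth ψ →
      ∫ ω, f ω * arcDeriv ψ ω ∂arcLength = -∫ ω, g ω * ψ ω ∂arcLength

/-- `ρ` (restricted to times `t ≥ 0`) is a weak solution of
`∂ₜρ = Δρ - ∇·(ρ P_{ω^⊥} Ω_ρ)` on the circle: it is weakly continuous in time, it belongs to
`L²_loc([0,∞), W^{1,1})`, and the equation holds when tested against every smooth function. -/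
structure IsWeakSolution (ρ : ℝ → ProbabilityMeasure Circle) : Prop where
  weakly_continuous : ContinuousOn ρ (Ici 0)
  mem_L2loc_W11 : ∃ u v : ℝ × Circle → ℝ, Measurable u ∧ Measurable v ∧
    (∀ᵐ t ∂(volume.restrict (Ici (0 : ℝ))),
      HasDensity (ρ t) (fun ω => u (t, ω)) ∧
      HasWeakDerivL1 (fun ω => u (t, ω)) (fun ω => v (t, ω))) ∧
    ∀ T : ℝ, IntegrableOn
      (fun t => ((∫ ω, |u (t, ω)| ∂arcLength) + ∫ ω, |v (t, ω)| ∂arcLength) ^ 2) (Icc 0 T)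
  equation : ∀ ψ : Circle → ℝ, IsSmooth ψ → ∀ t : ℝ, 0 ≤ t →
    ∫ ω, ψ ω ∂(ρ t : Measure Circle) = ∫ ω, ψ ω ∂(ρ 0 : Measure Circle) +
      ∫ r in (0 : ℝ)..t, ∫ ω, (laplacian ψ ω + ⟪projPerp ω (direction (ρ r)), grad ψ ω⟫_ℝ)
        ∂(ρ r : Measure Circle)

/-- The Fisher-von Mises density `M_Ω(ω) = C_M e^{ω·Ω}`, where `C_M = 1 / ∫ e^{ω·Ω} dω`. -/
def vonMises (Ω : ℂ) (ω : Circle) : ℝ :=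
  (∫ η : Circle, Real.exp ⟪(η : ℂ), Ω⟫_ℝ ∂arcLength)⁻¹ * Real.exp ⟪(ω : ℂ), Ω⟫_ℝ

/-- The relative Fisher information `I(f | g) = ∫ |∇ log (f / g)|² f dω` of a positive `C¹` density
`f` with respect to a positive `C¹` density `g`. -/
def fisherInfo (f g : Circle → ℝ) : ℝ :=
  ∫ ω, ‖grad (fun η => Real.log (f η / g η)) ω‖ ^ 2 * f ω ∂arcLength

end Vicsek

end

noncomputable section

namespace Vicsek

/-! ### The circle through its angle -/

/-! The proof reads the equation on the moments `c_n = ∫ ω^n dρ`, which satisfy `c_n' = -n² c_n +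
(n/2)(Ω c_{n-1} - conj Ω c_{n+1})`, and then works with the resulting classical solution.

The flux `J = c_1` stays nonzero. As long as it does, `Re (Ω conj J) = |J|` dominates the `c_2` term
because `|c_2| ≤ 1`, so `(|J|²)' ≥ -2|J|²` and `|J|² e^{2t}` cannot decrease to zero
(`flux_ne_zero`). Hence `Ω` is continuous in time and every moment equation is a genuine ODE.

Smoothness is a bootstrap in `n` (`moment_decay`): the damping `n²` against a coupling of size `|n|`
gains one power of `n` per step, at the price of a little time. For `t > 0` the moments therefore
decay faster than any power, and their Fourier series is a smooth density `u` solving `∂_t u = ∂_θ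
G`, where `G = ∂_θ u - b u` and `b` is the tangential component of `Ω`. Testing with the negative
part gives `u ≥ 0`; a moving barrier carries positivity from one point to every later point
(`pos_of_nonneg_of_parabolic`).

With `p = G / u = ∂_θ log (u / M_Ω)`, the Fisher information is `I = ∫ u p²`. Differentiation and
integration by parts give `I' = -2 ∫ u (∂_θ p)² + 2 ∫ (∂_θ b) u p² + 2 ⟪Ω', J'⟫`. The first term has
a good sign and the second is at most `2 I` since `|∂_θ b| ≤ 1`. The last comes from the motion of
the target `M_Ω`: `Ω'` is the projection of `J'` orthogonal to `J`, divided by `|J|`, so `⟪Ω', J'⟫ ≤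
|J'|² / |J|`; and `|J'|² ≤ I`, because `J'` is an integral against the current `G`. Thus `I' ≤ (2 +
2/|J|) I`, and Grönwall's argument concludes. -/

theorem arcDeriv_exp (f : Circle → ℝ) (θ : ℝ) :
    arcDeriv f (Circle.exp θ) = deriv (fun φ : ℝ => f (Circle.exp φ)) θ := by
  have h : (fun φ : ℝ => f (Circle.exp θ * Circle.exp φ)) =
      fun φ : ℝ => (fun φ : ℝ => f (Circle.exp φ)) (θ + φ) := by
    funext φ; simp [Circle.exp_add]
  rw [arcDeriv, h]
  exact (deriv_comp_const_add (fun φ : ℝ => f (Circle.exp φ)) θ 0).trans (by rw [add_zero])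

theorem integral_arcLength {E : Type*} [NormedAddCommGroup E] [NormedSpace ℝ E]
    {f : Circle → E} (hf : StronglyMeasurable f) :
    ∫ ω, f ω ∂arcLength = ∫ θ in (-π)..π, f (Circle.exp θ) := by
  rw [arcLength, integral_map (Circle.exp.continuous.measurable.aemeasurable)
    hf.aestronglyMeasurable, intervalIntegral.integral_of_le (by linarith [Real.pi_pos])]

instance instIsFiniteMeasureArcLength : IsFiniteMeasure arcLength := by
  unfold arcLength; infer_instance

/-- The function on the circle with the given `2π`-periodic lift. -/
def ofLift (F : ℝ → ℝ) (ω : Circle) : ℝ := F (Complex.arg ω)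

theorem ofLift_exp {F : ℝ → ℝ} (hF : Function.Periodic F (2 * π)) (θ : ℝ) :
    ofLift F (Circle.exp θ) = F θ := by
  obtain ⟨m, hm⟩ := Circle.exp_eq_exp.1 (Circle.exp_arg (Circle.exp θ))
  rw [ofLift, hm]
  exact hF.int_mul m θ

theorem continuous_coe_circle : Continuous fun ω : Circle => (ω : ℂ) :=
  continuous_induced_dom

theorem measurable_ofLift {F : ℝ → ℝ} (hF : Continuous F) : Measurable (ofLift F) :=
  hF.measurable.comp (Complex.measurable_arg.comp continuous_coe_circle.measurable)

theorem laplacian_exp (f : Circle → ℝ) (θ : ℝ) :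
    laplacian f (Circle.exp θ) = deriv (deriv (fun φ : ℝ => f (Circle.exp φ))) θ := by
  rw [laplacian, arcDeriv_exp]
  congr 1; funext φ; exact arcDeriv_exp f φ

theorem exists_exp_eq (ω : Circle) : ∃ θ : ℝ, Circle.exp θ = ω := ⟨_, Circle.exp_arg ω⟩

theorem inner_projPerp_grad (f : Circle → ℝ) (ω : Circle) (v : ℂ) :
    ⟪projPerp ω v, grad f ω⟫_ℝ = arcDeriv f ω * ⟪v, Complex.I * (ω : ℂ)⟫_ℝ := by
  have h : ⟪(ω : ℂ), Complex.I * (ω : ℂ)⟫_ℝ = 0 := by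
    simp [Complex.inner]; ring
  rw [projPerp, grad, inner_smul_right, inner_sub_left, inner_smul_left, h]; simp

theorem inner_I_mul_exp (v : ℂ) (θ : ℝ) :
    ⟪v, Complex.I * (Circle.exp θ : ℂ)⟫_ℝ = -v.re * Real.sin θ + v.im * Real.cos θ := by
  simp [Complex.inner, Circle.coe_exp, Complex.exp_re, Complex.exp_im]; ring

theorem inner_exp (v : ℂ) (θ : ℝ) :
    ⟪(Circle.exp θ : ℂ), v⟫_ℝ = v.re * Real.cos θ + v.im * Real.sin θ := by
  simp [Complex.inner, Circle.coe_exp, Complex.exp_re, Complex.exp_im]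

/-! ### Moments -/

/-- The `n`-th trigonometric moment. -/
def moment (μ : ProbabilityMeasure Circle) (n : ℤ) : ℂ :=
  ∫ ω : Circle, (ω : ℂ) ^ n ∂(μ : Measure Circle)

theorem continuous_coe_zpow (n : ℤ) : Continuous fun ω : Circle => (ω : ℂ) ^ n :=
  continuous_coe_circle.zpow₀ n fun ω => Or.inl (Circle.coe_ne_zero ω)

theorem integrable_of_continuous {E : Type*} [NormedAddCommGroup E]
    (μ : Measure Circle) [IsFiniteMeasure μ] {f : Circle → E}
    (hf : Continuous f) : Integrable f μ := by
  exact hf.integrable_of_hasCompactSupport (HasCompactSupport.of_compactSpace f)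

theorem norm_moment_le (μ : ProbabilityMeasure Circle) (n : ℤ) : ‖moment μ n‖ ≤ 1 := by
  refine (norm_integral_le_integral_norm _).trans ?_
  have h : ∀ ω : Circle, ‖(ω : ℂ) ^ n‖ = 1 := fun ω => by
    rw [norm_zpow, Circle.norm_coe, one_zpow]
  simp_rw [h]
  simp

theorem moment_zero (μ : ProbabilityMeasure Circle) : moment μ 0 = 1 := by
  simp [moment]

theorem moment_one (μ : ProbabilityMeasure Circle) : moment μ 1 = flux μ := by
  simp [moment, flux]

/-- The right-hand side of the equation for the `n`-th moment. -/
def momentRate (μ : ProbabilityMeasure Circle) (n : ℤ) : ℂ :=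
  -(n : ℂ) ^ 2 * moment μ n + (n : ℂ) / 2 * (direction μ * moment μ (n - 1) -
    (starRingEnd ℂ) (direction μ) * moment μ (n + 1))

/-- The generator applied to the `n`-th trigonometric monomial. -/
def generatorZpow (v : ℂ) (n : ℤ) (ω : Circle) : ℂ :=
  -(n : ℂ) ^ 2 * (ω : ℂ) ^ n + (n : ℂ) / 2 * (v * (ω : ℂ) ^ (n - 1) -
    (starRingEnd ℂ) v * (ω : ℂ) ^ (n + 1))

theorem integral_generatorZpow (μ : ProbabilityMeasure Circle) (n : ℤ) :
    ∫ ω, generatorZpow (direction μ) n ω ∂(μ : Measure Circle) = momentRate μ n := by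
  have h := fun k => integrable_of_continuous (μ : Measure Circle) (continuous_coe_zpow k)
  unfold generatorZpow momentRate moment
  have h1 := (h (n - 1)).const_mul (direction μ)
  have h2 := (h (n + 1)).const_mul ((starRingEnd ℂ) (direction μ))
  refine (integral_add ((h n).const_mul (-(n : ℂ) ^ 2))
    ((h1.sub h2).const_mul ((n : ℂ) / 2))).trans ?_
  rw [integral_const_mul]
  congr 1
  refine (integral_const_mul _ _).trans ?_
  congr 1
  refine (integral_sub h1 h2).trans ?_
  rw [integral_const_mul, integral_const_mul]

theorem coe_exp_zpow (n : ℤ) (θ : ℝ) :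
    (Circle.exp θ : ℂ) ^ n = Complex.exp (n * θ * Complex.I) := by
  rw [Circle.coe_exp, ← Complex.exp_int_mul]; congr 1; ring

theorem hasDerivAt_exp_zpow (n : ℤ) (θ : ℝ) :
    HasDerivAt (fun φ : ℝ => (Circle.exp φ : ℂ) ^ n)
      (n * Complex.I * (Circle.exp θ : ℂ) ^ n) θ := by
  simp_rw [coe_exp_zpow]
  have h1 : HasDerivAt (fun φ : ℝ => (φ : ℂ)) 1 θ := HasDerivAt.ofReal_comp (hasDerivAt_id θ)
  have h2 := ((h1.const_mul (n : ℂ)).mul_const Complex.I).cexp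
  convert h2 using 1; ring

/-- The weak equation only admits real test functions, so a complex monomial is tested through real
functionals `L`. The drift shifts the exponent by one in each direction because `conj ω = ω⁻¹` on
the circle. -/
theorem generator_clm_zpow (L : ℂ →L[ℝ] ℝ) (v : ℂ) (n : ℤ) (ω : Circle) :
    laplacian (fun η => L ((η : ℂ) ^ n)) ω +
      ⟪projPerp ω v, grad (fun η => L ((η : ℂ) ^ n)) ω⟫_ℝ = L (generatorZpow v n ω) := by
  obtain ⟨θ, rfl⟩ := exists_exp_eq ω
  have d : ∀ (z : ℂ) (θ : ℝ), HasDerivAt (fun φ : ℝ => L (z * (Circle.exp φ : ℂ) ^ n))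
      (L (z * (n * Complex.I) * (Circle.exp θ : ℂ) ^ n)) θ := fun z θ => by
    have := L.hasFDerivAt.comp_hasDerivAt θ ((hasDerivAt_exp_zpow n θ).const_mul z)
    rw [mul_assoc]; exact this
  have d1 : deriv (fun φ : ℝ => L ((Circle.exp φ : ℂ) ^ n)) =
      fun φ => L (n * Complex.I * (Circle.exp φ : ℂ) ^ n) := by
    funext φ
    have := (d 1 φ).deriv
    simpa using this
  rw [laplacian_exp, inner_projPerp_grad, arcDeriv_exp, d1, (d _ θ).deriv, mul_comm (L _),
    ← smul_eq_mul (a := (⟪v, Complex.I * (Circle.exp θ : ℂ)⟫_ℝ : ℝ)), ← L.map_smul, ← L.map_add]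
  congr 1
  have h0 : (Circle.exp θ : ℂ) ≠ 0 := Circle.coe_ne_zero _
  have hinner : ((⟪v, Complex.I * (Circle.exp θ : ℂ)⟫_ℝ : ℝ) : ℂ) =
      ((starRingEnd ℂ) v * (Complex.I * (Circle.exp θ : ℂ)) -
        v * Complex.I * (Circle.exp θ : ℂ)⁻¹) / 2 := by
    rw [← Circle.coe_inv, Circle.coe_inv_eq_conj]
    generalize (Circle.exp θ : ℂ) = z
    apply Complex.ext <;> simp [Complex.inner] <;> ring
  rw [Complex.real_smul, hinner, generatorZpow, zpow_add₀ h0, zpow_sub₀ h0, zpow_one]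
  linear_combination ((Circle.exp θ : ℂ) ^ n * (n : ℂ) ^ 2 +
    (n : ℂ) / 2 * (Circle.exp θ : ℂ) ^ n * ((starRingEnd ℂ) v * (Circle.exp θ : ℂ) -
      v * (Circle.exp θ : ℂ)⁻¹)) * Complex.I_sq

theorem isSmooth_clm_zpow (L : ℂ →L[ℝ] ℝ) (n : ℤ) :
    IsSmooth fun η => L ((η : ℂ) ^ n) := by
  unfold IsSmooth
  simp_rw [coe_exp_zpow]
  refine L.contDiff.comp (ContDiff.cexp ?_)
  exact (contDiff_const.mul Complex.ofRealCLM.contDiff).mul contDiff_const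

/-! ### The moment equations and the flux -/

theorem clm_moment (L : ℂ →L[ℝ] ℝ) (μ : ProbabilityMeasure Circle) (n : ℤ) :
    ∫ ω : Circle, L ((ω : ℂ) ^ n) ∂(μ : Measure Circle) = L (moment μ n) :=
  L.integral_comp_comm (integrable_of_continuous _ (continuous_coe_zpow n))

theorem continuous_clm_moment (L : ℂ →L[ℝ] ℝ) (n : ℤ) :
    Continuous fun μ : ProbabilityMeasure Circle => L (moment μ n) := by
  simp_rw [← clm_moment]
  exact ProbabilityMeasure.continuous_integral_boundedContinuousFunction
    (BoundedContinuousFunction.mkOfCompact ⟨_, L.continuous.comp (continuous_coe_zpow n)⟩)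

theorem continuous_moment (n : ℤ) :
    Continuous fun μ : ProbabilityMeasure Circle => moment μ n := by
  have h1 := continuous_clm_moment Complex.reCLM n
  have h2 := continuous_clm_moment Complex.imCLM n
  refine ((Complex.continuous_ofReal.comp h1).add
    ((Complex.continuous_ofReal.comp h2).mul (continuous_const (y := Complex.I)))).congr fun μ => ?_
  exact Complex.re_add_im (moment μ n)

theorem continuous_flux : Continuous flux :=
  (continuous_moment 1).congr moment_one

theorem norm_direction_le (μ : ProbabilityMeasure Circle) : ‖direction μ‖ ≤ 1 := by
  rw [direction, norm_smul, norm_inv, norm_norm]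
  exact inv_mul_le_one

theorem continuousAt_direction {μ : ProbabilityMeasure Circle} (h : flux μ ≠ 0) :
    ContinuousAt direction μ :=
  (continuous_flux.norm.continuousAt.inv₀ (norm_ne_zero_iff.2 h)).smul
    continuous_flux.continuousAt

theorem continuousAt_momentRate {μ : ProbabilityMeasure Circle} (h : flux μ ≠ 0) (n : ℤ) :
    ContinuousAt (fun μ => momentRate μ n) μ := by
  have hd := continuousAt_direction h
  have hm := fun n => (continuous_moment n).continuousAt (x := μ)
  exact (continuousAt_const.mul (hm n)).add (continuousAt_const.mul
    ((hd.mul (hm _)).sub ((Complex.continuous_conj.continuousAt.comp hd).mul (hm _))))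

theorem IsWeakSolution.clm_moment_eq {ρ : ℝ → ProbabilityMeasure Circle} (hρ : IsWeakSolution ρ)
    (L : ℂ →L[ℝ] ℝ) (n : ℤ) {t : ℝ} (ht : 0 ≤ t) :
    L (moment (ρ t) n) = L (moment (ρ 0) n) + ∫ r in (0 : ℝ)..t, L (momentRate (ρ r) n) := by
  have h := hρ.equation _ (isSmooth_clm_zpow L n) t ht
  simp_rw [generator_clm_zpow] at h
  rw [clm_moment, clm_moment] at h
  rw [h]
  congr 2
  funext r
  rw [← integral_generatorZpow]
  refine L.integral_comp_comm (integrable_of_continuous _ ?_)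
  unfold generatorZpow
  exact (continuous_const.mul (continuous_coe_zpow n)).add (continuous_const.mul
    ((continuous_const.mul (continuous_coe_zpow _)).sub
      (continuous_const.mul (continuous_coe_zpow _))))

/-- The horizon `T` is needed because the right-hand side is known to be continuous only up to the
first time the flux might vanish. -/
theorem hasDerivAt_of_eq_integral {f g : ℝ → ℝ} {T : ℝ}
    (h : ∀ t, 0 ≤ t → f t = f 0 + ∫ r in (0 : ℝ)..t, g r) (hg : ContinuousOn g (Ico 0 T))
    {t : ℝ} (ht : t ∈ Ioo 0 T) : HasDerivAt f (g t) t := by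
  have hnhds : Ico 0 T ∈ nhds t := Filter.mem_of_superset (Ioo_mem_nhds ht.1 ht.2) Ioo_subset_Ico_self
  have hint : IntervalIntegrable g volume 0 t := by
    refine (hg.mono ?_).intervalIntegrable
    rw [uIcc_of_le ht.1.le]
    exact fun x hx => ⟨hx.1, hx.2.trans_lt ht.2⟩
  have hd := (intervalIntegral.integral_hasDerivAt_right hint
    ((hg.mono Ioo_subset_Ico_self).stronglyMeasurableAtFilter isOpen_Ioo t ht)
    (hg.continuousAt hnhds)).const_add (f 0)
  refine hd.congr_of_eventuallyEq ?_
  filter_upwards [Ioi_mem_nhds ht.1] with s hs using h s (le_of_lt hs)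

theorem IsWeakSolution.hasDerivAt_moment_of_flux_ne_zero {ρ : ℝ → ProbabilityMeasure Circle}
    (hρ : IsWeakSolution ρ) {T : ℝ} (hT : ∀ t ∈ Ico 0 T, flux (ρ t) ≠ 0) (n : ℤ)
    {t : ℝ} (ht : t ∈ Ioo 0 T) :
    HasDerivAt (fun t => moment (ρ t) n) (momentRate (ρ t) n) t := by
  have hc : ContinuousOn (fun t => momentRate (ρ t) n) (Ico 0 T) := fun s hs =>
    (continuousAt_momentRate (hT s hs) n).comp_continuousWithinAt
      ((hρ.weakly_continuous s hs.1).mono Ico_subset_Ici_self)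
  have key := fun L : ℂ →L[ℝ] ℝ => hasDerivAt_of_eq_integral (f := fun t => L (moment (ρ t) n))
    (fun t h => hρ.clm_moment_eq L n h) (L.continuous.comp_continuousOn hc) ht
  refine (((key Complex.reCLM).ofReal_comp.fun_add
    ((key Complex.imCLM).ofReal_comp.mul_const Complex.I)).congr_deriv
      (Complex.re_add_im _)).congr_of_eventuallyEq (.of_forall fun t => ?_)
  exact (Complex.re_add_im _).symm

/-- Diffusion contributes exactly `-|J|²`. Alignment contributes half of `|J| - Re (conj Ω · c_2 ·
conj J)`, which is nonnegative since `|Ω| ≤ 1` and `|c_2| ≤ 1`. -/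
theorem re_flux_mul_momentRate (μ : ProbabilityMeasure Circle) :
    -‖flux μ‖ ^ 2 ≤ (momentRate μ 1 * (starRingEnd ℂ) (flux μ)).re := by
  have h1 : direction μ * (starRingEnd ℂ) (flux μ) = ‖flux μ‖ := by
    rcases eq_or_ne (flux μ) 0 with h | h
    · simp [direction, h]
    · have h' : (‖flux μ‖ : ℂ) ≠ 0 := by simpa using h
      rw [direction, Complex.real_smul, mul_assoc, Complex.mul_conj']
      push_cast; field_simp
  have h2 : ‖(starRingEnd ℂ) (direction μ) * moment μ 2 * (starRingEnd ℂ) (flux μ)‖ ≤ ‖flux μ‖ := by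
    rw [norm_mul, norm_mul, RCLike.norm_conj, RCLike.norm_conj]
    have := mul_le_one₀ (norm_direction_le μ) (norm_nonneg _) (norm_moment_le μ 2)
    exact mul_le_of_le_one_left (norm_nonneg _) this
  have h3 := (Complex.re_le_norm _).trans h2
  have h4 : momentRate μ 1 * (starRingEnd ℂ) (flux μ) = -(‖flux μ‖ : ℂ) ^ 2 +
      1 / 2 * (‖flux μ‖ - (starRingEnd ℂ) (direction μ) * moment μ 2 * (starRingEnd ℂ) (flux μ)) := by
    rw [momentRate, ← Complex.mul_conj']
    norm_num [moment_zero, moment_one]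
    linear_combination (1 / 2) * h1
  rw [h4]
  generalize (starRingEnd ℂ) (direction μ) * moment μ 2 * (starRingEnd ℂ) (flux μ) = z at h3
  have : (-(‖flux μ‖ : ℂ) ^ 2 + 1 / 2 * (‖flux μ‖ - z)).re = -‖flux μ‖ ^ 2 + 1 / 2 * (‖flux μ‖ - z.re) := by
    have e : (-(‖flux μ‖ : ℂ) ^ 2 + 1 / 2 * (‖flux μ‖ - z)) =
      ((-‖flux μ‖ ^ 2 + 1 / 2 * ‖flux μ‖ : ℝ) : ℂ) - ((1 / 2 : ℝ) : ℂ) * z := by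
      push_cast; ring
    rw [e, Complex.sub_re, Complex.re_ofReal_mul, Complex.ofReal_re]; ring
  rw [this]
  linarith

theorem IsWeakSolution.flux_ne_zero {ρ : ℝ → ProbabilityMeasure Circle} (hρ : IsWeakSolution ρ)
    (h0 : flux (ρ 0) ≠ 0) {t : ℝ} (ht : 0 ≤ t) : flux (ρ t) ≠ 0 := by
  intro hzero
  have hc : ContinuousOn (fun t => flux (ρ t)) (Ici 0) :=
    continuous_flux.comp_continuousOn hρ.weakly_continuous
  have hcomp : IsCompact (Icc 0 t ∩ (fun t => flux (ρ t)) ⁻¹' {0}) :=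
    isCompact_Icc.of_isClosed_subset
      ((hc.mono Icc_subset_Ici_self).preimage_isClosed_of_isClosed isClosed_Icc isClosed_singleton)
      inter_subset_left
  -- Up to the first zero `T` of the flux the moment equations hold pointwise, so the monotone
  -- quantity `|J|² e^{2r}` can be followed up to `T`, where it would have to vanish.
  obtain ⟨T, ⟨⟨hT0, hTt⟩, hT⟩, hmin⟩ := hcomp.exists_isLeast ⟨t, ⟨ht, le_rfl⟩, hzero⟩
  have hT' : flux (ρ T) = 0 := hT
  have hne : ∀ r ∈ Ico 0 T, flux (ρ r) ≠ 0 := fun r hr h =>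
    (hmin ⟨⟨hr.1, hr.2.le.trans hTt⟩, h⟩).not_gt hr.2
  have hd : ∀ r ∈ Ioo 0 T, HasDerivAt (fun r => ‖flux (ρ r)‖ ^ 2 * Real.exp (2 * r))
      ((2 * (momentRate (ρ r) 1 * (starRingEnd ℂ) (flux (ρ r))).re) * Real.exp (2 * r) +
        ‖flux (ρ r)‖ ^ 2 * (Real.exp (2 * r) * 2)) r := fun r hr => by
    have h1 := hρ.hasDerivAt_moment_of_flux_ne_zero hne 1 hr
    simp_rw [moment_one] at h1
    have h2 := h1.norm_sq
    have h3 : HasDerivAt (fun r : ℝ => Real.exp (2 * r)) (Real.exp (2 * r) * 2) r := by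
      simpa using ((hasDerivAt_id r).const_mul 2).exp
    refine (h2.fun_mul h3).congr_deriv ?_
    rw [Complex.inner]
  have hmono : MonotoneOn (fun r => ‖flux (ρ r)‖ ^ 2 * Real.exp (2 * r)) (Icc 0 T) := by
    refine monotoneOn_of_deriv_nonneg (convex_Icc 0 T) ?_ ?_ ?_
    · exact ((hc.mono Icc_subset_Ici_self).norm.pow 2).mul (by fun_prop)
    · rw [interior_Icc]; exact fun r hr => (hd r hr).differentiableAt.differentiableWithinAt
    · rw [interior_Icc]; intro r hr
      rw [(hd r hr).deriv]
      have := re_flux_mul_momentRate (ρ r)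
      have he := Real.exp_pos (2 * r)
      nlinarith
  have h := hmono ⟨le_rfl, hT0⟩ ⟨hT0, le_rfl⟩ hT0
  simp [hT'] at h
  exact h0 h

theorem IsWeakSolution.hasDerivAt_moment {ρ : ℝ → ProbabilityMeasure Circle}
    (hρ : IsWeakSolution ρ) (h0 : flux (ρ 0) ≠ 0) (n : ℤ) {t : ℝ} (ht : 0 < t) :
    HasDerivAt (fun t => moment (ρ t) n) (momentRate (ρ t) n) t :=
  hρ.hasDerivAt_moment_of_flux_ne_zero (T := t + 1)
    (fun _ hr => hρ.flux_ne_zero h0 hr.1) n ⟨ht, by linarith⟩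

/-! ### Rapid decay of the moments -/

/-- Variation of constants: `e^{l(s-a)} f` has derivative `e^{l(s-a)} g`, whose norm is the
derivative of the comparison function. -/
theorem norm_le_of_hasDerivAt_linear {f g : ℝ → ℂ} {l M a t : ℝ} (hl : 0 < l) (hat : a ≤ t)
    (hf : ∀ s ∈ Icc a t, HasDerivAt f (-(l : ℂ) * f s + g s) s)
    (hg : ∀ s ∈ Icc a t, ‖g s‖ ≤ M) :
    ‖f t‖ ≤ Real.exp (-(l * (t - a))) * ‖f a‖ + M / l := by
  have hM : 0 ≤ M := (norm_nonneg _).trans (hg a ⟨le_rfl, hat⟩)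
  have he : ∀ s, HasDerivAt (fun s => Real.exp (l * (s - a))) (Real.exp (l * (s - a)) * l) s :=
    fun s => by simpa using (((hasDerivAt_id s).sub_const a).const_mul l).exp
  have hF : ∀ s ∈ Icc a t, HasDerivAt (fun s => (Real.exp (l * (s - a)) : ℂ) * f s)
      ((Real.exp (l * (s - a)) : ℂ) * g s) s := fun s hs =>
    ((he s).ofReal_comp.fun_mul (hf s hs)).congr_deriv (by push_cast; ring)
  have hB : ∀ s, HasDerivAt (fun s => ‖f a‖ + M / l * (Real.exp (l * (s - a)) - 1))
      (Real.exp (l * (s - a)) * M) s := fun s =>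
    ((((he s).sub_const 1).const_mul (M / l)).const_add _).congr_deriv (by field_simp)
  have key := image_norm_le_of_norm_deriv_right_le_deriv_boundary
    (fun s hs => (hF s hs).continuousAt.continuousWithinAt)
    (fun s hs => (hF s (Ico_subset_Icc_self hs)).hasDerivWithinAt) (B := fun s =>
      ‖f a‖ + M / l * (Real.exp (l * (s - a)) - 1)) (by simp) hB
    (fun s hs => by
      rw [norm_mul, Complex.norm_real, Real.norm_eq_abs, abs_of_pos (Real.exp_pos _)]
      exact mul_le_mul_of_nonneg_left (hg s (Ico_subset_Icc_self hs)) (Real.exp_pos _).le)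
    ⟨hat, le_rfl⟩
  rw [norm_mul, Complex.norm_real, Real.norm_eq_abs, abs_of_pos (Real.exp_pos _)] at key
  rw [Real.exp_neg]
  have hp := Real.exp_pos (l * (t - a))
  generalize Real.exp (l * (t - a)) = e at key hp
  have h2 : 0 ≤ M / l := by positivity
  rw [← mul_le_mul_iff_right₀ hp]
  have : e * (e⁻¹ * ‖f a‖ + M / l) = ‖f a‖ + M / l * e := by field_simp
  rw [this]; linarith

theorem pow_mul_exp_neg_le {c : ℝ} (hc : 0 < c) (N : ℕ) {n : ℤ} (hn : n ≠ 0) :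
    (1 + |(n : ℝ)|) ^ N * Real.exp (-((n : ℝ) ^ 2 * c)) ≤ (2 / c) ^ N * N.factorial := by
  have h1 : (1 : ℝ) ≤ |(n : ℝ)| := by exact_mod_cast Int.one_le_abs hn
  have h2 : 1 + |(n : ℝ)| ≤ (2 / c) * ((n : ℝ) ^ 2 * c) := by
    rw [← sq_abs]; field_simp; nlinarith
  have h3 := Real.pow_div_factorial_le_exp (x := (n : ℝ) ^ 2 * c) (by positivity) N
  rw [Real.exp_neg]
  calc _ ≤ ((2 / c) * ((n : ℝ) ^ 2 * c)) ^ N * (Real.exp ((n : ℝ) ^ 2 * c))⁻¹ := by gcongr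
    _ = (2 / c) ^ N * (((n : ℝ) ^ 2 * c) ^ N * (Real.exp ((n : ℝ) ^ 2 * c))⁻¹) := by
      rw [mul_pow]; ring
    _ ≤ _ := by
      gcongr
      rw [div_le_iff₀ (by positivity)] at h3
      rw [← div_eq_mul_inv, div_le_iff₀ (Real.exp_pos _)]
      linarith

theorem weight_le_weight_shift (n m : ℤ) (h : |n - m| ≤ 1) :
    1 + |(n : ℝ)| ≤ 2 * (1 + |(m : ℝ)|) := by
  have h1 : |(n : ℝ) - m| ≤ 1 := by exact_mod_cast h
  have h2 := abs_sub_abs_le_abs_sub (n : ℝ) m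
  have := abs_nonneg (m : ℝ)
  linarith

variable {ρ : ℝ → ProbabilityMeasure Circle}

/-- Each induction step gains one power of `n`: the coupling is `|n|` times moments already of order
`|n|^{-N}`, and dividing by the damping rate `n²` leaves `|n|^{-N-1}`. The value at the earlier time
is killed by `e^{-n² δ/2}`. -/
theorem IsWeakSolution.moment_decay (hρ : IsWeakSolution ρ) (h0 : flux (ρ 0) ≠ 0) (N : ℕ) :
    ∀ δ : ℝ, 0 < δ → ∃ C : ℝ, 0 ≤ C ∧ ∀ (n : ℤ) (t : ℝ), δ ≤ t →
      (1 + |(n : ℝ)|) ^ N * ‖moment (ρ t) n‖ ≤ C := by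
  induction N with
  | zero => exact fun δ _ => ⟨1, zero_le_one, fun n t _ => by simpa using norm_moment_le _ n⟩
  | succ N ih =>
    intro δ hδ
    obtain ⟨C, hC, hb⟩ := ih (δ / 2) (half_pos hδ)
    -- The `1` serves the undamped mode `n = 0`; the two summands bound the initial-value term and
    -- the coupling term for `n ≠ 0`.
    refine ⟨max 1 ((2 / (δ / 2)) ^ (N + 1) * (N + 1).factorial + 2 ^ (N + 1) * C),
      le_max_of_le_left zero_le_one, fun n t ht => ?_⟩
    rcases eq_or_ne n 0 with rfl | hn
    · simp [moment_zero]
    refine le_trans ?_ (le_max_right _ _)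
    have hn1 : (1 : ℝ) ≤ |(n : ℝ)| := by exact_mod_cast Int.one_le_abs hn
    have hW : 0 < (1 + |(n : ℝ)|) ^ N := by positivity
    have hshift : ∀ m : ℤ, |n - m| ≤ 1 → ∀ s, δ / 2 ≤ s →
        ‖moment (ρ s) m‖ ≤ 2 ^ N * C / (1 + |(n : ℝ)|) ^ N := fun m hm s hs => by
      rw [le_div_iff₀ hW]
      calc _ ≤ ‖moment (ρ s) m‖ * (2 * (1 + |(m : ℝ)|)) ^ N := by
            gcongr; exact weight_le_weight_shift n m hm
        _ = 2 ^ N * ((1 + |(m : ℝ)|) ^ N * ‖moment (ρ s) m‖) := by rw [mul_pow]; ring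
        _ ≤ _ := by gcongr; exact hb m s hs
    set K := 2 ^ N * C / (1 + |(n : ℝ)|) ^ N with hK
    have hK0 : 0 ≤ K := by positivity
    have hl : (0 : ℝ) < (n : ℝ) ^ 2 := by positivity
    -- Starting at `t - δ/2 ≥ δ/2` keeps the whole interval inside the range of the induction
    -- hypothesis.
    have hode := norm_le_of_hasDerivAt_linear (f := fun t => moment (ρ t) n)
      (g := fun t => (n : ℂ) / 2 * (direction (ρ t) * moment (ρ t) (n - 1) -
        (starRingEnd ℂ) (direction (ρ t)) * moment (ρ t) (n + 1)))
      (M := |(n : ℝ)| * K) (a := t - δ / 2) (t := t) hl (by linarith)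
      (fun s hs => (hρ.hasDerivAt_moment h0 n (by linarith [hs.1])).congr_deriv
        (by rw [momentRate]; push_cast; rfl))
      (fun s hs => by
        have hs' : δ / 2 ≤ s := by linarith [hs.1]
        have e1 := hshift (n - 1) (by simp) s hs'
        have e2 := hshift (n + 1) (by simp) s hs'
        have hd := norm_direction_le (ρ s)
        have e3 : ‖direction (ρ s) * moment (ρ s) (n - 1) -
            (starRingEnd ℂ) (direction (ρ s)) * moment (ρ s) (n + 1)‖ ≤ K + K := by
          refine (norm_sub_le _ _).trans (add_le_add ?_ ?_)
          · rw [norm_mul]; exact (mul_le_of_le_one_left (norm_nonneg _) hd).trans e1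
          · rw [norm_mul, RCLike.norm_conj]
            exact (mul_le_of_le_one_left (norm_nonneg _) hd).trans e2
        rw [norm_mul, norm_div, Complex.norm_intCast, Complex.norm_two]
        calc _ ≤ |(n : ℝ)| / 2 * (K + K) := by gcongr
          _ = _ := by ring)
    have e4 : t - (t - δ / 2) = δ / 2 := by ring
    rw [e4] at hode
    have hexp := pow_mul_exp_neg_le (half_pos hδ) (N + 1) hn
    have hW1 : 0 < (1 + |(n : ℝ)|) ^ (N + 1) := by positivity
    have e5 : (1 + |(n : ℝ)|) ^ (N + 1) * (|(n : ℝ)| * K / (n : ℝ) ^ 2) ≤ 2 ^ (N + 1) * C := by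
      rw [hK, ← sq_abs (n : ℝ)]
      have : (1 + |(n : ℝ)|) ^ (N + 1) * (|(n : ℝ)| * (2 ^ N * C / (1 + |(n : ℝ)|) ^ N) / |(n : ℝ)| ^ 2)
          = (1 + |(n : ℝ)|) / |(n : ℝ)| * (2 ^ N * C) := by field_simp; ring
      rw [this, pow_succ, mul_right_comm, mul_comm (2 ^ N * C)]
      gcongr
      rw [div_le_iff₀ (by linarith)]; linarith
    calc _ ≤ (1 + |(n : ℝ)|) ^ (N + 1) *
          (Real.exp (-((n : ℝ) ^ 2 * (δ / 2))) * 1 + |(n : ℝ)| * K / (n : ℝ) ^ 2) := by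
          gcongr
          refine hode.trans ?_
          gcongr
          exact norm_moment_le _ n
      _ = (1 + |(n : ℝ)|) ^ (N + 1) * Real.exp (-((n : ℝ) ^ 2 * (δ / 2))) +
          (1 + |(n : ℝ)|) ^ (N + 1) * (|(n : ℝ)| * K / (n : ℝ) ^ 2) := by ring
      _ ≤ _ := add_le_add hexp e5

theorem IsWeakSolution.momentRate_decay (hρ : IsWeakSolution ρ) (h0 : flux (ρ 0) ≠ 0) (N : ℕ)
    (δ : ℝ) (hδ : 0 < δ) : ∃ C : ℝ, 0 ≤ C ∧ ∀ (n : ℤ) (t : ℝ), δ ≤ t →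
      (1 + |(n : ℝ)|) ^ N * ‖momentRate (ρ t) n‖ ≤ C := by
  obtain ⟨C, hC, hb⟩ := hρ.moment_decay h0 (N + 2) δ hδ
  refine ⟨C + 2 ^ (N + 1) * C, by positivity, fun n t ht => ?_⟩
  have hd := norm_direction_le (ρ t)
  have hshift : ∀ m : ℤ, |n - m| ≤ 1 →
      (1 + |(n : ℝ)|) ^ (N + 1) * ‖moment (ρ t) m‖ ≤ 2 ^ (N + 1) * C := fun m hm =>
    calc _ ≤ (2 * (1 + |(m : ℝ)|)) ^ (N + 1) * ‖moment (ρ t) m‖ := by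
          gcongr; exact weight_le_weight_shift n m hm
      _ = 2 ^ (N + 1) * ((1 + |(m : ℝ)|) ^ (N + 1) * ‖moment (ρ t) m‖) := by rw [mul_pow]; ring
      _ ≤ 2 ^ (N + 1) * ((1 + |(m : ℝ)|) ^ (N + 2) * ‖moment (ρ t) m‖) := by
          gcongr
          · linarith [abs_nonneg (m : ℝ)]
          · omega
      _ ≤ _ := by gcongr; exact hb m t ht
  have e1 := hshift (n - 1) (by simp)
  have e2 := hshift (n + 1) (by simp)
  have e0 := hb n t ht
  have hrate : ‖momentRate (ρ t) n‖ ≤ |(n : ℝ)| ^ 2 * ‖moment (ρ t) n‖ +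
      |(n : ℝ)| / 2 * (‖moment (ρ t) (n - 1)‖ + ‖moment (ρ t) (n + 1)‖) := by
    rw [momentRate]
    refine (norm_add_le _ _).trans (add_le_add ?_ ?_)
    · rw [norm_mul, norm_neg, norm_pow, Complex.norm_intCast]
    · rw [norm_mul, norm_div, Complex.norm_intCast, Complex.norm_two]
      gcongr
      refine (norm_sub_le _ _).trans (add_le_add ?_ ?_)
      · rw [norm_mul]; exact mul_le_of_le_one_left (norm_nonneg _) hd
      · rw [norm_mul, RCLike.norm_conj]; exact mul_le_of_le_one_left (norm_nonneg _) hd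
  have hn := abs_nonneg (n : ℝ)
  calc _ ≤ (1 + |(n : ℝ)|) ^ N * ((1 + |(n : ℝ)|) ^ 2 * ‖moment (ρ t) n‖ +
      (1 + |(n : ℝ)|) / 2 * (‖moment (ρ t) (n - 1)‖ + ‖moment (ρ t) (n + 1)‖)) := by
        gcongr
        refine hrate.trans ?_
        gcongr <;> linarith
    _ = (1 + |(n : ℝ)|) ^ (N + 2) * ‖moment (ρ t) n‖ +
        ((1 + |(n : ℝ)|) ^ (N + 1) * ‖moment (ρ t) (n - 1)‖ +
          (1 + |(n : ℝ)|) ^ (N + 1) * ‖moment (ρ t) (n + 1)‖) / 2 := by ring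
    _ ≤ _ := by linarith

/-! ### Time-dependent Fourier series -/

/-- The coefficients `a t n` decay faster than any power of `n`, locally uniformly in `t > 0`. -/
def UniformDecay (a : ℝ → ℤ → ℂ) : Prop :=
  ∀ (N : ℕ) (δ : ℝ), 0 < δ → ∃ C : ℝ, 0 ≤ C ∧ ∀ (n : ℤ) (t : ℝ), δ ≤ t →
    (1 + |(n : ℝ)|) ^ N * ‖a t n‖ ≤ C

/-- The `n`-th term of the `j`-th derivative of the Fourier series with coefficients `a t`. -/
def fourierTerm (a : ℝ → ℤ → ℂ) (j : ℕ) (t θ : ℝ) (n : ℤ) : ℂ :=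
  (-(n * Complex.I)) ^ j * a t n * (Circle.exp θ : ℂ) ^ (-n)

/-- The `j`-th derivative of the Fourier series with coefficients `a t`. -/
def fourierSum (a : ℝ → ℤ → ℂ) (j : ℕ) (t θ : ℝ) : ℂ := ∑' n : ℤ, fourierTerm a j t θ n

theorem summable_weight (C : ℝ) : Summable fun n : ℤ => C / (1 + |(n : ℝ)|) ^ 2 := by
  have h : Summable fun n : ℤ => |(n : ℝ)| ^ (-(2 : ℝ)) :=
    Real.summable_abs_int_rpow (by norm_num)
  have h1 : Summable fun n : ℤ => 1 / (1 + |(n : ℝ)|) ^ 2 := by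
    refine Summable.of_norm_bounded_eventually h ?_
    rw [Filter.eventually_cofinite]
    refine (Set.finite_singleton (0 : ℤ)).subset fun n hn => ?_
    by_contra h0
    apply hn
    have h0' : (n : ℝ) ≠ 0 := by exact_mod_cast h0
    have hpos : 0 < |(n : ℝ)| := abs_pos.2 h0'
    rw [Real.norm_eq_abs, abs_of_pos (by positivity), Real.rpow_neg hpos.le, one_div]
    rw [Real.rpow_two]
    exact inv_anti₀ (by positivity) (pow_le_pow_left₀ hpos.le (by linarith) 2)
  exact (h1.mul_left C).congr fun n => by ring

theorem norm_fourierTerm (a : ℝ → ℤ → ℂ) (j : ℕ) (t θ : ℝ) (n : ℤ) :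
    ‖fourierTerm a j t θ n‖ = |(n : ℝ)| ^ j * ‖a t n‖ := by
  rw [fourierTerm, norm_mul, norm_mul, norm_pow, norm_neg, norm_mul, Complex.norm_intCast,
    Complex.norm_I, mul_one, norm_zpow, Circle.norm_coe, one_zpow, mul_one]

theorem UniformDecay.exists_bound {a : ℝ → ℤ → ℂ} (ha : UniformDecay a) (j : ℕ) {δ : ℝ}
    (hδ : 0 < δ) : ∃ C : ℝ, 0 ≤ C ∧ ∀ (n : ℤ) (t θ : ℝ), δ ≤ t →
      ‖fourierTerm a j t θ n‖ ≤ C / (1 + |(n : ℝ)|) ^ 2 := by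
  obtain ⟨C, hC, h⟩ := ha (j + 2) δ hδ
  refine ⟨C, hC, fun n t θ ht => ?_⟩
  rw [norm_fourierTerm, le_div_iff₀ (by positivity)]
  calc _ = |(n : ℝ)| ^ j * (1 + |(n : ℝ)|) ^ 2 * ‖a t n‖ := by ring
    _ ≤ (1 + |(n : ℝ)|) ^ j * (1 + |(n : ℝ)|) ^ 2 * ‖a t n‖ := by gcongr; linarith
    _ = (1 + |(n : ℝ)|) ^ (j + 2) * ‖a t n‖ := by ring
    _ ≤ C := h n t ht

theorem UniformDecay.summable {a : ℝ → ℤ → ℂ} (ha : UniformDecay a) (j : ℕ) {t : ℝ}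
    (ht : 0 < t) (θ : ℝ) : Summable (fourierTerm a j t θ) := by
  obtain ⟨C, -, h⟩ := ha.exists_bound j ht
  exact Summable.of_norm_bounded (summable_weight C) fun n => h n t θ le_rfl

theorem hasDerivAt_fourierTerm (a : ℝ → ℤ → ℂ) (j : ℕ) (t θ : ℝ) (n : ℤ) :
    HasDerivAt (fun θ => fourierTerm a j t θ n) (fourierTerm a (j + 1) t θ n) θ :=
  ((hasDerivAt_exp_zpow (-n) θ).const_mul _).congr_deriv (by
    rw [fourierTerm]; push_cast; ring)

theorem UniformDecay.hasDerivAt_fourierSum {a : ℝ → ℤ → ℂ} (ha : UniformDecay a) (j : ℕ) {t : ℝ}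
    (ht : 0 < t) (θ : ℝ) :
    HasDerivAt (fun θ => fourierSum a j t θ) (fourierSum a (j + 1) t θ) θ := by
  obtain ⟨C, -, h⟩ := ha.exists_bound (j + 1) ht
  exact hasDerivAt_tsum_of_isPreconnected (summable_weight C) isOpen_univ isPreconnected_univ
    (g := fun n θ => fourierTerm a j t θ n) (g' := fun n θ => fourierTerm a (j + 1) t θ n)
    (fun n y _ => hasDerivAt_fourierTerm a j t y n) (fun n y _ => h n t y le_rfl)
    (mem_univ θ) (ha.summable j ht θ) (mem_univ θ)

/-- Termwise differentiation is legitimate on times beyond `t / 2`, where the differentiated series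
has a summable bound independent of time. -/
theorem UniformDecay.hasDerivAt_fourierSum_time {a a' : ℝ → ℤ → ℂ} (ha : UniformDecay a)
    (ha' : UniformDecay a') (hd : ∀ (n : ℤ) (t : ℝ), 0 < t → HasDerivAt (fun t => a t n) (a' t n) t)
    (j : ℕ) {t : ℝ} (ht : 0 < t) (θ : ℝ) :
    HasDerivAt (fun t => fourierSum a j t θ) (fourierSum a' j t θ) t := by
  obtain ⟨C, -, h⟩ := ha'.exists_bound j (half_pos ht)
  exact hasDerivAt_tsum_of_isPreconnected (summable_weight C) (isOpen_Ioi (a := t / 2))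
    isPreconnected_Ioi
    (g := fun n t => fourierTerm a j t θ n) (g' := fun n t => fourierTerm a' j t θ n)
    (fun n y hy => ((hd n y ((half_pos ht).trans hy)).const_mul _).mul_const _)
    (fun n y hy => h n y θ (le_of_lt hy))
    (half_lt_self ht) (ha.summable j ht θ) (half_lt_self ht)

theorem UniformDecay.continuousOn_fourierSum {a : ℝ → ℤ → ℂ} (ha : UniformDecay a)
    (hc : ∀ n : ℤ, ContinuousOn (fun t => a t n) (Ioi 0)) (j : ℕ) :
    ContinuousOn (fun p : ℝ × ℝ => fourierSum a j p.1 p.2) (Ioi 0 ×ˢ univ) := by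
  rintro ⟨t, θ⟩ ⟨ht, -⟩
  have ht : 0 < t := ht
  obtain ⟨C, -, h⟩ := ha.exists_bound j (half_pos ht)
  have hcont : ContinuousOn (fun p : ℝ × ℝ => fourierSum a j p.1 p.2) (Ioi (t / 2) ×ˢ univ) := by
    refine continuousOn_tsum (fun n => ?_) (summable_weight C)
      (fun n p hp => h n p.1 p.2 (le_of_lt hp.1))
    refine (continuousOn_const.mul ((hc n).comp continuousOn_fst fun p hp =>
      (half_pos ht).trans hp.1)).mul ?_
    exact ((continuous_coe_zpow (-n)).comp
      (Circle.exp.continuous.comp continuous_snd)).continuousOn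
  exact (hcont.continuousAt (prod_mem_nhds (Ioi_mem_nhds (half_lt_self ht)) Filter.univ_mem)).continuousWithinAt

theorem integral_exp_zpow (n : ℤ) :
    ∫ θ in (-π)..π, (Circle.exp θ : ℂ) ^ n = if n = 0 then 2 * (π : ℂ) else 0 := by
  split_ifs with h
  · subst h; simp; ring
  · have hn : (n : ℂ) * Complex.I ≠ 0 := by simp [h]
    have := intervalIntegral.integral_eq_sub_of_hasDerivAt (a := -π) (b := π)
      (f := fun θ => (Circle.exp θ : ℂ) ^ n / (n * Complex.I))
      (fun θ _ => ((hasDerivAt_exp_zpow n θ).div_const _).congr_deriv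
        (mul_div_cancel_left₀ _ hn))
      (((continuous_coe_zpow n).comp Circle.exp.continuous).intervalIntegrable _ _)
    rw [this]
    have e : Circle.exp (-π) = Circle.exp π := by
      rw [← Circle.exp_sub_two_pi π]; congr 1; ring
    rw [e, sub_self]

/-- The series uses `e^{-inθ}` since the moments integrate `ω^n`; orthogonality then selects the
term `n = m`, and division by `2π` gives a density with the prescribed moments. -/
theorem UniformDecay.integral_zpow_mul_fourierSum {a : ℝ → ℤ → ℂ} (ha : UniformDecay a) {t : ℝ}
    (ht : 0 < t) (m : ℤ) :
    ∫ θ in (-π)..π, (Circle.exp θ : ℂ) ^ m * fourierSum a 0 t θ = 2 * π * a t m := by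
  obtain ⟨C, -, h⟩ := ha.exists_bound 0 ht
  have hcont : ∀ n, Continuous fun θ : ℝ => (Circle.exp θ : ℂ) ^ m * fourierTerm a 0 t θ n :=
    fun n => ((continuous_coe_zpow m).comp Circle.exp.continuous).mul
      (continuous_const.mul ((continuous_coe_zpow (-n)).comp Circle.exp.continuous))
  have hs := intervalIntegral.hasSum_integral_of_dominated_convergence (a := -π) (b := π)
    (μ := volume)
    (F := fun n θ => (Circle.exp θ : ℂ) ^ m * fourierTerm a 0 t θ n)
    (f := fun θ => (Circle.exp θ : ℂ) ^ m * fourierSum a 0 t θ)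
    (fun n _ => C / (1 + |(n : ℝ)|) ^ 2)
    (fun n => (hcont n).aestronglyMeasurable)
    (fun n => .of_forall fun θ _ => by
      rw [norm_mul, norm_zpow, Circle.norm_coe, one_zpow, one_mul]; exact h n t θ le_rfl)
    (.of_forall fun θ _ => summable_weight C)
    (by simp)
    (.of_forall fun θ _ => (ha.summable 0 ht θ).hasSum.mul_left _)
  rw [← hs.tsum_eq, tsum_eq_single m]
  · have : ∀ θ : ℝ, (Circle.exp θ : ℂ) ^ m * fourierTerm a 0 t θ m = a t m := fun θ => by
      rw [fourierTerm, zpow_neg]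
      have : (Circle.exp θ : ℂ) ^ m ≠ 0 := zpow_ne_zero _ (Circle.coe_ne_zero _)
      field_simp
    simp_rw [this]
    rw [intervalIntegral.integral_const, Complex.real_smul]; push_cast; ring
  · intro n hn
    have : ∀ θ : ℝ, (Circle.exp θ : ℂ) ^ m * fourierTerm a 0 t θ n =
        a t n * (Circle.exp θ : ℂ) ^ (m - n) := fun θ => by
      rw [fourierTerm, sub_eq_add_neg, zpow_add₀ (Circle.coe_ne_zero _)]; ring
    simp_rw [this]
    rw [intervalIntegral.integral_const_mul, integral_exp_zpow, if_neg (by omega), mul_zero]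

/-! ### The Fourier series of a weak solution -/

/-- This turns the moment system back into the pointwise equation `∂_t u = ∂²u - b ∂u - (∂b) u`.
Shifting the index turns the neighbouring coefficients into factors `z^{±1}`, which combine into `b`
and `∂b`. -/
theorem fourierSum_momentRate (hdec : UniformDecay fun t n => moment (ρ t) n) {t : ℝ} (ht : 0 < t)
    (θ : ℝ) :
    fourierSum (fun t n => momentRate (ρ t) n) 0 t θ =
      fourierSum (fun t n => moment (ρ t) n) 2 t θ -
      ((-(direction (ρ t)).re * Real.sin θ + (direction (ρ t)).im * Real.cos θ : ℝ) : ℂ) *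
        fourierSum (fun t n => moment (ρ t) n) 1 t θ -
      ((-(direction (ρ t)).re * Real.cos θ - (direction (ρ t)).im * Real.sin θ : ℝ) : ℂ) *
        fourierSum (fun t n => moment (ρ t) n) 0 t θ := by
  set a : ℝ → ℤ → ℂ := fun t n => moment (ρ t) n with ha
  set z : ℂ := (Circle.exp θ : ℂ) with hz
  have hz0 : z ≠ 0 := Circle.coe_ne_zero _
  have s := fun j => (hdec.summable j ht θ).hasSum
  set v := direction (ρ t)
  have h1 : HasSum (fun n : ℤ => (n : ℂ) / 2 * (v * a t (n - 1)) * z ^ (-n))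
      (v / 2 * z⁻¹ * (Complex.I * fourierSum a 1 t θ + fourierSum a 0 t θ)) := by
    rw [← (Equiv.addRight (1 : ℤ)).hasSum_iff]
    refine ((((s 1).mul_left Complex.I).add (s 0)).mul_left (v / 2 * z⁻¹)).congr_fun ?_
    intro n
    simp only [Function.comp, Equiv.coe_addRight, fourierTerm, neg_add, zpow_add₀ hz0,
      add_sub_cancel_right, zpow_neg_one, ← hz]
    push_cast
    linear_combination (v / 2 * z⁻¹ * n * a t n * z ^ (-n)) * Complex.I_sq
  have h2 : HasSum (fun n : ℤ => (n : ℂ) / 2 * ((starRingEnd ℂ) v * a t (n + 1)) * z ^ (-n))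
      ((starRingEnd ℂ) v / 2 * z * (Complex.I * fourierSum a 1 t θ - fourierSum a 0 t θ)) := by
    rw [← (Equiv.subRight (1 : ℤ)).hasSum_iff]
    refine ((((s 1).mul_left Complex.I).sub (s 0)).mul_left ((starRingEnd ℂ) v / 2 * z)).congr_fun ?_
    intro n
    simp only [Function.comp, Equiv.subRight_apply, fourierTerm, neg_sub, zpow_sub₀ hz0,
      sub_add_cancel, zpow_one, zpow_neg, ← hz]
    push_cast
    linear_combination ((starRingEnd ℂ) v / 2 * z * n * a t n * (z ^ n)⁻¹) * Complex.I_sq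
  have h3 := ((s 2).add h1).sub h2
  have h4 : HasSum (fourierTerm (fun t n => momentRate (ρ t) n) 0 t θ) _ := h3.congr_fun fun n => by
    simp only [fourierTerm, momentRate, ← hz, ha]
    linear_combination (-(n : ℂ) ^ 2 * moment (ρ t) n * z ^ (-n)) * Complex.I_sq
  rw [fourierSum, h4.tsum_eq]
  have e1 : ((-v.re * Real.sin θ + v.im * Real.cos θ : ℝ) : ℂ) =
      ((starRingEnd ℂ) v * (Complex.I * z) - v * Complex.I * z⁻¹) / 2 := by
    rw [hz, ← inner_I_mul_exp, ← Circle.coe_inv, Circle.coe_inv_eq_conj]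
    generalize (Circle.exp θ : ℂ) = z
    apply Complex.ext <;> simp [Complex.inner] <;> ring
  have e2 : ((-v.re * Real.cos θ - v.im * Real.sin θ : ℝ) : ℂ) =
      -((starRingEnd ℂ) v * z + v * z⁻¹) / 2 := by
    have : -v.re * Real.cos θ - v.im * Real.sin θ = -⟪(Circle.exp θ : ℂ), v⟫_ℝ := by
      rw [inner_exp]; ring
    rw [this, hz, ← Circle.coe_inv, Circle.coe_inv_eq_conj]
    generalize (Circle.exp θ : ℂ) = z
    apply Complex.ext
    · simp [Complex.inner]
    · simp [Complex.inner]; ring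
  rw [e1, e2]
  change fourierSum a 2 t θ + _ - _ = _
  ring

/-! ### Measures determined by their Fourier coefficients -/

/-- Both sides are bounded linear functionals of `ψ` in the sup norm. They agree on trigonometric
polynomials, which are dense. -/
theorem integral_eq_of_moments {μ : Measure Circle} [IsFiniteMeasure μ] {G : ℝ → ℂ}
    (hG : Continuous G)
    (h : ∀ n : ℤ, ∫ ω : Circle, (ω : ℂ) ^ n ∂μ = ∫ θ in (-π)..π, (Circle.exp θ : ℂ) ^ n * G θ)
    {ψ : Circle → ℂ} (hψ : Continuous ψ) :
    ∫ ω, ψ ω ∂μ = ∫ θ in (-π)..π, ψ (Circle.exp θ) * G θ := by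
  have hfact : Fact (0 < 2 * π) := ⟨Real.two_pi_pos⟩
  let e := AddCircle.homeomorphCircle'
  have c1 : ∀ f : C(AddCircle (2 * π), ℂ), Integrable (fun ω => f (e.symm ω)) μ := fun f =>
    integrable_of_continuous μ (f.continuous.comp e.symm.continuous)
  have c2 : ∀ f : C(AddCircle (2 * π), ℂ),
      IntervalIntegrable (fun θ : ℝ => f (θ : AddCircle (2 * π)) * G θ) volume (-π) π := fun f =>
    ((f.continuous.comp (AddCircle.continuous_mk' _)).mul hG).intervalIntegrable _ _
  let L : C(AddCircle (2 * π), ℂ) →ₗ[ℂ] ℂ :=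
    { toFun := fun f => ∫ ω, f (e.symm ω) ∂μ -
        ∫ θ in (-π)..π, f (θ : AddCircle (2 * π)) * G θ
      map_add' := fun f g => by
        simp only [ContinuousMap.add_apply, add_mul]
        rw [integral_add (c1 f) (c1 g), intervalIntegral.integral_add (c2 f) (c2 g)]
        ring
      map_smul' := fun c f => by
        simp only [ContinuousMap.smul_apply, smul_eq_mul, mul_assoc, RingHom.id_apply]
        rw [integral_const_mul, intervalIntegral.integral_const_mul]
        ring }
  have hpi : -π ≤ π := by linarith [Real.pi_pos]
  have hbound : ∀ f, ‖L f‖ ≤ (μ.real univ + ∫ θ in (-π)..π, ‖G θ‖) * ‖f‖ := fun f => by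
    refine (norm_sub_le _ _).trans ?_
    rw [add_mul]
    refine add_le_add ?_ ?_
    · rw [mul_comm (μ.real univ)]
      exact norm_integral_le_of_norm_le_const (.of_forall fun ω => f.norm_coe_le_norm _)
    · refine (intervalIntegral.norm_integral_le_integral_norm hpi).trans ?_
      rw [← intervalIntegral.integral_mul_const]
      refine intervalIntegral.integral_mono_on hpi (c2 f).norm
        ((hG.norm.mul continuous_const).intervalIntegrable _ _) fun θ _ => ?_
      rw [norm_mul, mul_comm]
      exact mul_le_mul_of_nonneg_left (f.norm_coe_le_norm _) (norm_nonneg _)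
  have hdense : Dense (Submodule.span ℂ (range (@fourier (2 * π))) :
      Set C(AddCircle (2 * π), ℂ)) := by
    rw [dense_iff_closure_eq, ← Submodule.topologicalClosure_coe, span_fourier_closure_eq_top]
    rfl
  have hmk : ∀ θ : ℝ, e (θ : AddCircle (2 * π)) = Circle.exp θ :=
    AddCircle.homeomorphCircle'_apply_mk
  have hfou : ∀ (n : ℤ) (x : AddCircle (2 * π)), fourier n x = (e x : ℂ) ^ n := fun n x => by
    induction x using QuotientAddGroup.induction_on with
    | H θ =>
      rw [hmk, fourier_coe_apply, coe_exp_zpow]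
      congr 1
      have : (π : ℂ) ≠ 0 := by exact_mod_cast Real.pi_ne_zero
      push_cast
      field_simp
  have hzero : L.mkContinuous _ hbound = 0 := by
    refine ContinuousLinearMap.ext_on hdense ?_
    rintro _ ⟨n, rfl⟩
    change ∫ ω, fourier n (e.symm ω) ∂μ - ∫ θ in (-π)..π, fourier n (θ : AddCircle (2 * π)) * G θ = 0
    simp_rw [hfou, e.apply_symm_apply, hmk]
    rw [h n, sub_self]
  have hL := congrArg (fun A : C(AddCircle (2 * π), ℂ) →L[ℂ] ℂ => A ⟨_, hψ.comp e.continuous⟩) hzero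
  change ∫ ω, ψ (e (e.symm ω)) ∂μ - ∫ θ in (-π)..π, ψ (e (θ : AddCircle (2 * π))) * G θ = 0 at hL
  simp_rw [e.apply_symm_apply, hmk] at hL
  exact sub_eq_zero.1 hL

theorem continuous_ofLift {F : ℝ → ℝ} (hF : Continuous F) (hp : Function.Periodic F (2 * π)) :
    Continuous (ofLift F) := by
  have hl : Continuous (hp.lift : AddCircle (2 * π) → ℝ) := continuous_quot_lift _ hF
  refine (hl.comp AddCircle.homeomorphCircle'.symm.continuous).congr fun ω => ?_
  obtain ⟨θ, rfl⟩ := exists_exp_eq ω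
  rw [ofLift_exp hp, Function.comp, ← AddCircle.homeomorphCircle'_apply_mk,
    Homeomorph.symm_apply_apply, hp.lift_coe]

/-! ### The density of a weak solution -/

/-- The drift `v ↦ ω^⊥ · v` at angle `θ`. -/
def drift (v : ℂ) (θ : ℝ) : ℝ := -v.re * Real.sin θ + v.im * Real.cos θ

/-- The angular derivative of the drift. -/
def driftDeriv (v : ℂ) (θ : ℝ) : ℝ := -v.re * Real.cos θ - v.im * Real.sin θ

theorem hasDerivAt_drift (v : ℂ) (θ : ℝ) : HasDerivAt (drift v) (driftDeriv v θ) θ :=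
  (((Real.hasDerivAt_sin θ).const_mul _).add ((Real.hasDerivAt_cos θ).const_mul _)).congr_deriv
    (by rw [driftDeriv]; ring)

theorem hasDerivAt_driftDeriv (v : ℂ) (θ : ℝ) : HasDerivAt (driftDeriv v) (-drift v θ) θ :=
  (((Real.hasDerivAt_cos θ).const_mul _).sub ((Real.hasDerivAt_sin θ).const_mul _)).congr_deriv
    (by rw [drift]; ring)

theorem abs_drift_le (v : ℂ) (θ : ℝ) : |drift v θ| ≤ ‖v‖ := by
  rw [show drift v θ = ⟪v, Complex.I * (Circle.exp θ : ℂ)⟫_ℝ from (inner_I_mul_exp v θ).symm]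
  refine (abs_real_inner_le_norm _ _).trans ?_
  rw [norm_mul, Complex.norm_I, Circle.norm_coe, one_mul, mul_one]

theorem abs_driftDeriv_le (v : ℂ) (θ : ℝ) : |driftDeriv v θ| ≤ ‖v‖ := by
  rw [show driftDeriv v θ = -⟪(Circle.exp θ : ℂ), v⟫_ℝ by rw [inner_exp, driftDeriv]; ring, abs_neg]
  refine (abs_real_inner_le_norm _ _).trans ?_
  rw [Circle.norm_coe, one_mul]

/-- The `j`-th angular derivative of the density, in terms of the angle. -/
def density (ρ : ℝ → ProbabilityMeasure Circle) (j : ℕ) (t θ : ℝ) : ℝ :=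
  (fourierSum (fun t n => moment (ρ t) n) j t θ).re / (2 * π)

/-- The `j`-th angular derivative of the time derivative of the density. -/
def densityRate (ρ : ℝ → ProbabilityMeasure Circle) (j : ℕ) (t θ : ℝ) : ℝ :=
  (fourierSum (fun t n => momentRate (ρ t) n) j t θ).re / (2 * π)

theorem periodic_density (j : ℕ) (t : ℝ) : Function.Periodic (density ρ j t) (2 * π) := fun θ => by
  simp only [density, fourierSum, fourierTerm, Circle.exp_add_two_pi]

theorem hasDerivAt_re_div {f : ℝ → ℂ} {f' : ℂ} {x : ℝ} (h : HasDerivAt f f' x) (c : ℝ) :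
    HasDerivAt (fun x => (f x).re / c) (f'.re / c) x :=
  (Complex.reCLM.hasFDerivAt.comp_hasDerivAt x h).div_const c

namespace IsWeakSolution

variable (hρ : IsWeakSolution ρ) (h0 : flux (ρ 0) ≠ 0)
include hρ h0

theorem uniformDecay_moment : UniformDecay fun t n => moment (ρ t) n := hρ.moment_decay h0

theorem uniformDecay_momentRate : UniformDecay fun t n => momentRate (ρ t) n :=
  hρ.momentRate_decay h0

theorem hasDerivAt_density (j : ℕ) {t : ℝ} (ht : 0 < t) (θ : ℝ) :
    HasDerivAt (density ρ j t) (density ρ (j + 1) t θ) θ :=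
  hasDerivAt_re_div ((hρ.uniformDecay_moment h0).hasDerivAt_fourierSum j ht θ) _

theorem hasDerivAt_densityRate (j : ℕ) {t : ℝ} (ht : 0 < t) (θ : ℝ) :
    HasDerivAt (densityRate ρ j t) (densityRate ρ (j + 1) t θ) θ :=
  hasDerivAt_re_div ((hρ.uniformDecay_momentRate h0).hasDerivAt_fourierSum j ht θ) _

theorem hasDerivAt_density_time (j : ℕ) {t : ℝ} (ht : 0 < t) (θ : ℝ) :
    HasDerivAt (fun t => density ρ j t θ) (densityRate ρ j t θ) t :=
  hasDerivAt_re_div ((hρ.uniformDecay_moment h0).hasDerivAt_fourierSum_time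
    (hρ.uniformDecay_momentRate h0) (fun n _ ht => hρ.hasDerivAt_moment h0 n ht) j ht θ) _

omit h0 in
theorem continuousOn_flux : ContinuousOn (fun t => flux (ρ t)) (Ici 0) :=
  continuous_flux.comp_continuousOn hρ.weakly_continuous

theorem continuousOn_direction : ContinuousOn (fun t => direction (ρ t)) (Ici 0) := fun t ht =>
  (continuousAt_direction (hρ.flux_ne_zero h0 ht)).comp_continuousWithinAt
    (hρ.weakly_continuous t ht)

theorem continuousOn_momentRate (n : ℤ) : ContinuousOn (fun t => momentRate (ρ t) n) (Ici 0) :=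
  fun t ht => (continuousAt_momentRate (hρ.flux_ne_zero h0 ht) n).comp_continuousWithinAt
    (hρ.weakly_continuous t ht)

theorem continuousOn_density (j : ℕ) :
    ContinuousOn (fun p : ℝ × ℝ => density ρ j p.1 p.2) (Ioi 0 ×ˢ univ) :=
  (Complex.continuous_re.comp_continuousOn
    ((hρ.uniformDecay_moment h0).continuousOn_fourierSum (fun n =>
      ((continuous_moment n).comp_continuousOn hρ.weakly_continuous).mono Ioi_subset_Ici_self)
      j)).div_const _

theorem continuousOn_densityRate (j : ℕ) :
    ContinuousOn (fun p : ℝ × ℝ => densityRate ρ j p.1 p.2) (Ioi 0 ×ˢ univ) :=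
  (Complex.continuous_re.comp_continuousOn
    ((hρ.uniformDecay_momentRate h0).continuousOn_fourierSum (fun n =>
      (hρ.continuousOn_momentRate h0 n).mono Ioi_subset_Ici_self) j)).div_const _

theorem continuous_density (j : ℕ) {t : ℝ} (ht : 0 < t) : Continuous (density ρ j t) :=
  continuous_iff_continuousAt.2 fun θ => (hρ.hasDerivAt_density h0 j ht θ).continuousAt

theorem contDiff_density {t : ℝ} (ht : 0 < t) : ContDiff ℝ (⊤ : ℕ∞) (density ρ 0 t) := by
  have h : ∀ k : ℕ, iteratedDeriv k (density ρ 0 t) = density ρ k t := fun k => by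
    induction k with
    | zero => exact iteratedDeriv_zero
    | succ k ih =>
      rw [iteratedDeriv_succ, ih]
      exact funext fun θ => (hρ.hasDerivAt_density h0 k ht θ).deriv
  refine contDiff_of_differentiable_iteratedDeriv fun m _ => ?_
  rw [h]
  exact fun θ => (hρ.hasDerivAt_density h0 m ht θ).differentiableAt

theorem densityRate_zero {t : ℝ} (ht : 0 < t) (θ : ℝ) :
    densityRate ρ 0 t θ = density ρ 2 t θ - drift (direction (ρ t)) θ * density ρ 1 t θ -
      driftDeriv (direction (ρ t)) θ * density ρ 0 t θ := by
  simp only [densityRate, density, drift, driftDeriv]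
  rw [fourierSum_momentRate (hρ.uniformDecay_moment h0) ht, Complex.sub_re, Complex.sub_re,
    Complex.re_ofReal_mul, Complex.re_ofReal_mul]
  ring

theorem integral_eq_density {t : ℝ} (ht : 0 < t) {ψ : Circle → ℝ} (hψ : Continuous ψ) :
    ∫ ω, ψ ω ∂(ρ t : Measure Circle) = ∫ θ in (-π)..π, ψ (Circle.exp θ) * density ρ 0 t θ := by
  have hdec := hρ.uniformDecay_moment h0
  have hc : Continuous fun θ => fourierSum (fun t n => moment (ρ t) n) 0 t θ :=
    continuous_iff_continuousAt.2 fun θ => (hdec.hasDerivAt_fourierSum 0 ht θ).continuousAt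
  have hpi : (π : ℂ) ≠ 0 := by exact_mod_cast Real.pi_ne_zero
  have h := integral_eq_of_moments (μ := (ρ t : Measure Circle)) (hc.div_const (2 * (π : ℂ)))
    (fun n => by
      simp_rw [← mul_div_assoc]
      rw [intervalIntegral.integral_div, hdec.integral_zpow_mul_fourierSum ht n]
      change moment (ρ t) n = _
      field_simp) (ψ := fun ω => (ψ ω : ℂ)) (Complex.continuous_ofReal.comp hψ)
  rw [integral_complex_ofReal] at h
  have hre := congrArg Complex.re h
  rw [Complex.ofReal_re] at hre
  rw [hre]
  have hint : IntervalIntegrable (fun θ => (ψ (Circle.exp θ) : ℂ) *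
      (fourierSum (fun t n => moment (ρ t) n) 0 t θ / (2 * π))) volume (-π) π :=
    ((Complex.continuous_ofReal.comp (hψ.comp Circle.exp.continuous)).mul
      (hc.div_const _)).intervalIntegrable _ _
  refine (Complex.reCLM.intervalIntegral_comp_comm hint).symm.trans ?_
  refine intervalIntegral.integral_congr fun θ _ => ?_
  have e : (2 * π : ℂ) = ((2 * π : ℝ) : ℂ) := by push_cast; rfl
  simp only [Complex.reCLM_apply, Complex.re_ofReal_mul, density, e, Complex.div_ofReal_re]

/-- Testing the positive measure against the negative part `u⁻` gives `0 ≤ ∫ u⁻ u = -∫ (u⁻)²`,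
impossible if the continuous `u` is negative anywhere. -/
theorem density_nonneg {t : ℝ} (ht : 0 < t) (θ : ℝ) : 0 ≤ density ρ 0 t θ := by
  have hU := hρ.continuous_density h0 0 ht
  have hp := periodic_density (ρ := ρ) 0 t
  have h := hρ.integral_eq_density h0 ht (ψ := fun ω => max (-ofLift (density ρ 0 t) ω) 0)
    ((continuous_ofLift hU hp).neg.max continuous_const)
  have h1 : 0 ≤ ∫ ω, max (-ofLift (density ρ 0 t) ω) 0 ∂(ρ t : Measure Circle) :=
    integral_nonneg fun ω => le_max_right _ _
  simp_rw [ofLift_exp hp] at h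
  by_contra! hneg
  -- A representative of the angle inside the interval of integration.
  set θ' := Complex.arg (Circle.exp θ) with hθ'
  have hθ : density ρ 0 t θ' = density ρ 0 t θ := ofLift_exp hp θ
  have hpos : 0 < ∫ θ in (-π)..π, -(max (-density ρ 0 t θ) 0 * density ρ 0 t θ) := by
    refine intervalIntegral.integral_pos (by linarith [Real.pi_pos])
      (((hU.neg.max continuous_const).mul hU).neg).continuousOn (fun x _ => ?_)
      ⟨θ', ⟨(Complex.neg_pi_lt_arg _).le, Complex.arg_le_pi _⟩, ?_⟩
    · rcases le_total 0 (density ρ 0 t x) with hx | hx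
      · rw [max_eq_right (by linarith)]; simp
      · rw [max_eq_left (by linarith)]; nlinarith
    · rw [hθ, max_eq_left (by linarith)]; nlinarith
  rw [intervalIntegral.integral_neg, ← h] at hpos
  linarith

theorem hasDensity_density {t : ℝ} (ht : 0 < t) :
    HasDensity (ρ t) (ofLift (density ρ 0 t)) := by
  have hU := hρ.continuous_density h0 0 ht
  have hp := periodic_density (ρ := ρ) 0 t
  have hc := continuous_ofLift hU hp
  have hnn : ∀ ω, 0 ≤ ofLift (density ρ 0 t) ω := fun ω => hρ.density_nonneg h0 ht _
  have hfin : IsFiniteMeasure (arcLength.withDensity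
      fun ω => ENNReal.ofReal (ofLift (density ρ 0 t) ω)) :=
    isFiniteMeasure_withDensity_ofReal (integrable_of_continuous _ hc).2
  refine ⟨.of_forall hnn, ext_of_forall_integral_eq_of_IsFiniteMeasure fun f => ?_⟩
  rw [hρ.integral_eq_density h0 ht f.continuous,
    integral_withDensity_eq_integral_toReal_smul
      (measurable_ofLift hU).ennreal_ofReal (.of_forall fun _ => ENNReal.ofReal_lt_top)]
  simp_rw [ENNReal.toReal_ofReal (hnn _)]
  have hs : StronglyMeasurable fun ω => ofLift (density ρ 0 t) ω • f ω :=
    Continuous.stronglyMeasurable (hc.smul f.continuous)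
  rw [integral_arcLength hs]
  simp_rw [ofLift_exp hp, smul_eq_mul, mul_comm]

theorem isSmooth_density {t : ℝ} (ht : 0 < t) : IsSmooth (ofLift (density ρ 0 t)) := by
  rw [IsSmooth, funext (ofLift_exp (periodic_density 0 t))]
  exact hρ.contDiff_density h0 ht

theorem integral_density {t : ℝ} (ht : 0 < t) : ∫ θ in (-π)..π, density ρ 0 t θ = 1 := by
  have h := hρ.integral_eq_density h0 ht (ψ := fun _ => 1) continuous_const
  simpa using h.symm

end IsWeakSolution

/-! ### Positivity of the density -/

/-- Only earlier times are compared, because the minimum in the barrier argument may sit at the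
final time. -/
theorem nonpos_of_hasDerivAt_of_left_min {g : ℝ → ℝ} {d a : ℝ} (hg : HasDerivAt g d a)
    (h : ∀ᶠ x in nhdsWithin a (Iio a), g a ≤ g x) : d ≤ 0 := by
  have ht := (hasDerivAt_iff_tendsto_slope_left_right.1 hg).1
  refine le_of_tendsto ht ?_
  filter_upwards [h, self_mem_nhdsWithin] with x hx hxa
  rw [slope_def_field]
  have hxa : x < a := hxa
  exact div_nonpos_of_nonneg_of_nonpos (by linarith) (by linarith)

theorem second_deriv_nonneg_of_isLocalMin {f f1 : ℝ → ℝ} {a f2 : ℝ} (hf : ∀ x, HasDerivAt f (f1 x) x)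
    (hf1 : HasDerivAt f1 f2 a) (h : IsLocalMin f a) : 0 ≤ f2 := by
  by_contra! hneg
  have ha : f1 a = 0 := h.hasDerivAt_eq_zero (hf a)
  have ht := (hasDerivAt_iff_tendsto_slope_left_right.1 hf1).2
  have hev : ∀ᶠ x in nhdsWithin a (Ioi a), f1 x < 0 := by
    filter_upwards [ht.eventually (gt_mem_nhds hneg), self_mem_nhdsWithin] with x hx hxa
    have hxa : a < x := hxa
    rw [slope_def_field, ha, sub_zero] at hx
    exact (div_neg_iff.1 hx).elim (fun h => absurd h.2 (by linarith)) fun h => h.1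
  obtain ⟨b, hb, hbs⟩ := mem_nhdsGT_iff_exists_Ioo_subset.1 hev
  have hb : a < b := hb
  have hmin : ∀ᶠ x in nhdsWithin a (Ioi a), f a ≤ f x := nhdsWithin_le_nhds h
  obtain ⟨x, hx, hxb⟩ := (hmin.and (Ioo_mem_nhdsGT hb)).exists
  obtain ⟨c, hc, hcx⟩ := exists_hasDerivAt_eq_slope f f1 hxb.1
    (fun y _ => (hf y).continuousAt.continuousWithinAt) (fun y _ => hf y)
  have hc1 : f1 c < 0 := hbs ⟨hc.1, hc.2.trans hxb.2⟩
  rw [hcx] at hc1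
  have : 0 ≤ (f x - f a) / (x - a) := div_nonneg (by linarith) (by linarith [hxb.1])
  linarith

/-- This says that `e^{-K(r-s)} q²` is a subsolution. Since `8y² - 4q = 8η² - 12q`, the terms linear
in `q` cost at most `(12 + 4 + 4|v|) q`. Completing the square with `8η²` absorbs them, and the
extra `1` in `K` absorbs `b1`. -/
theorem barrier_inequality {η v K q y b b1 : ℝ} (hη : 0 < η) (hη1 : η ≤ 1)
    (hK : K = 1 + (4 * |v| + 16) ^ 2 / (32 * η ^ 2)) (hq : q = η ^ 2 - y ^ 2) (hq0 : 0 ≤ q)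
    (hb : |b| ≤ 1) (hb1 : |b1| ≤ 1) :
    -K * q ^ 2 + 4 * v * q * y ≤ 8 * y ^ 2 - 4 * q + 4 * b * q * y - b1 * q ^ 2 := by
  have hy : |y| ≤ 1 := by
    rw [abs_le_one_iff_mul_self_le_one]; nlinarith
  have h1 : v * y ≤ |v| := (le_abs_self _).trans (by
    rw [abs_mul]; exact mul_le_of_le_one_right (abs_nonneg _) hy)
  have h2 : -(b * y) ≤ 1 := (neg_le_abs _).trans (by
    rw [abs_mul]; exact mul_le_one₀ hb (abs_nonneg _) hy)
  have h3 := mul_le_mul_of_nonneg_left h1 hq0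
  have h4 := mul_le_mul_of_nonneg_left h2 hq0
  have h5 : b1 * q ^ 2 ≤ q ^ 2 := mul_le_of_le_one_left (sq_nonneg q) (abs_le.1 hb1).2
  have h6 : 0 ≤ 8 * η ^ 2 * (1 - (4 * |v| + 16) / (16 * η ^ 2) * q) ^ 2 := by positivity
  have h7 : 8 * η ^ 2 * (1 - (4 * |v| + 16) / (16 * η ^ 2) * q) ^ 2 =
      8 * η ^ 2 - (4 * |v| + 16) * q + (K - 1) * q ^ 2 := by
    rw [hK]; field_simp; ring
  rw [h7] at h6
  have hy2 : y ^ 2 = η ^ 2 - q := by linarith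
  nlinarith

/-- A bump placed below `u` near `x0` at time `s` is transported at constant speed so that its
centre reaches `x1` at time `t`. Being a subsolution that vanishes on the edge of its moving
support, it stays below `u` by the maximum principle. -/
theorem pos_of_nonneg_of_parabolic {u u1 u2 ut b b1 : ℝ → ℝ → ℝ} {s t x0 x1 : ℝ} (hst : s < t)
    (hcont : ContinuousOn (fun p : ℝ × ℝ => u p.1 p.2) (Icc s t ×ˢ univ))
    (hu0 : ∀ r ∈ Icc s t, ∀ x, 0 ≤ u r x)
    (hu : ∀ r ∈ Icc s t, ∀ x, HasDerivAt (u r) (u1 r x) x)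
    (hu1 : ∀ r ∈ Icc s t, ∀ x, HasDerivAt (u1 r) (u2 r x) x)
    (hut : ∀ r ∈ Icc s t, ∀ x, HasDerivAt (fun r => u r x) (ut r x) r)
    (heq : ∀ r ∈ Icc s t, ∀ x, ut r x = u2 r x - b r x * u1 r x - b1 r x * u r x)
    (hb : ∀ r x, |b r x| ≤ 1) (hb1 : ∀ r x, |b1 r x| ≤ 1) (hpos : 0 < u s x0) :
    0 < u t x1 := by
  set v := (x1 - x0) / (t - s) with hv
  have hts : t - s ≠ 0 := by linarith
  obtain ⟨η, hη, hη1, hηu⟩ : ∃ η : ℝ, 0 < η ∧ η ≤ 1 ∧ ∀ x, |x - x0| ≤ η → u s x0 / 2 ≤ u s x := by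
    have h1 : ∀ᶠ x in nhds x0, u s x0 / 2 < u s x :=
      (hu s ⟨le_rfl, hst.le⟩ x0).continuousAt.eventually (lt_mem_nhds (half_lt_self hpos))
    obtain ⟨ε, hε, hball⟩ := Metric.eventually_nhds_iff.1 h1
    refine ⟨min 1 (ε / 2), by positivity, min_le_left _ _, fun x hx => (hball ?_).le⟩
    rw [Real.dist_eq]
    exact (hx.trans (min_le_right _ _)).trans_lt (half_lt_self hε)
  set l := u s x0 / 2 with hl
  have hl0 : 0 < l := half_pos hpos
  set K := 1 + (4 * |v| + 16) ^ 2 / (32 * η ^ 2) with hK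
  let y : ℝ → ℝ → ℝ := fun r x => x - x0 - v * (r - s)
  let q : ℝ → ℝ → ℝ := fun r x => η ^ 2 - y r x ^ 2
  let E : ℝ → ℝ := fun r => l * Real.exp (-K * (r - s))
  let w : ℝ → ℝ → ℝ := fun r x => E r * q r x ^ 2
  let w1 : ℝ → ℝ → ℝ := fun r x => E r * (2 * q r x * (-2 * y r x))
  -- The rate `2` strictly beats the bound `1` on the zeroth-order coefficient `b1`, so a negative
  -- minimum becomes contradictory.
  let Z : ℝ → ℝ → ℝ := fun r x => Real.exp (-2 * (r - s)) * (u r x - w r x)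
  have hE : ∀ r, 0 < E r := fun r => mul_pos hl0 (Real.exp_pos _)
  have hyx : ∀ r x, HasDerivAt (y r) 1 x := fun r x =>
    ((hasDerivAt_id x).sub_const x0).sub_const _
  have hyt : ∀ r x, HasDerivAt (fun r => y r x) (-v) r := fun r x =>
    ((((hasDerivAt_id r).sub_const s).const_mul v).const_sub (x - x0)).congr_deriv (by ring)
  have hqx : ∀ r x, HasDerivAt (q r) (-2 * y r x) x := fun r x =>
    (((hyx r x).fun_pow 2).const_sub (η ^ 2)).congr_deriv (by norm_num)
  have hqt : ∀ r x, HasDerivAt (fun r => q r x) (2 * v * y r x) r := fun r x =>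
    (((hyt r x).fun_pow 2).const_sub (η ^ 2)).congr_deriv (by norm_num; ring)
  have hwx : ∀ r x, HasDerivAt (w r) (w1 r x) x := fun r x =>
    (((hqx r x).fun_pow 2).const_mul (E r)).congr_deriv (by simp only [w1]; norm_num)
  have hwxx : ∀ r x, HasDerivAt (w1 r) (E r * (8 * y r x ^ 2 - 4 * q r x)) x := fun r x =>
    ((((hqx r x).const_mul 2).fun_mul ((hyx r x).const_mul (-2))).const_mul (E r)).congr_deriv
      (by ring)
  have hexp : ∀ c r, HasDerivAt (fun r => Real.exp (c * (r - s))) (Real.exp (c * (r - s)) * c) r :=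
    fun c r => by simpa using (((hasDerivAt_id r).sub_const s).const_mul c).exp
  have hwt : ∀ r x, HasDerivAt (fun r => w r x)
      (E r * (-K * q r x ^ 2 + 4 * v * q r x * y r x)) r := fun r x =>
    (((hexp (-K) r).const_mul l).fun_mul ((hqt r x).fun_pow 2)).congr_deriv
      (by simp only [E]; norm_num; ring)
  -- Straightens the slanted strip `|y| ≤ η` into a compact rectangle.
  let φ : ℝ × ℝ → ℝ × ℝ := fun p => (p.1, p.2 + x0 + v * (p.1 - s))
  have hφ : Continuous φ := by fun_prop
  have hyφ : ∀ p : ℝ × ℝ, y p.1 (φ p).2 = p.2 := fun p => by simp only [y, φ]; ring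
  have hZ : ContinuousOn (fun p : ℝ × ℝ => Z (φ p).1 (φ p).2) (Icc s t ×ˢ Icc (-η) η) := by
    refine ContinuousOn.mul (by fun_prop) (ContinuousOn.sub ?_ ?_)
    · exact hcont.comp hφ.continuousOn fun p hp => ⟨hp.1, mem_univ _⟩
    · simp only [w, E, q, y, φ]; fun_prop
  obtain ⟨⟨r, z⟩, ⟨hr, hz⟩, hmin⟩ := (isCompact_Icc.prod isCompact_Icc).exists_isMinOn
    ⟨(s, 0), ⟨le_rfl, hst.le⟩, by constructor <;> linarith⟩ hZ
  simp only at hr hz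
  set x := z + x0 + v * (r - s) with hx
  have hmin' : ∀ r' ∈ Icc s t, ∀ x', |y r' x'| ≤ η → Z r x ≤ Z r' x' := fun r' hr' x' hx' => by
    have h := hmin (a := (r', y r' x')) ⟨hr', abs_le.1 hx'⟩
    have e : y r' x' + x0 + v * (r' - s) = x' := by simp only [y]; ring
    simpa only [φ, mem_ofPred_eq, e] using h
  have hyz : y r x = z := hyφ (r, z)
  suffices hmain : 0 ≤ Z r x by
    have hy1 : y t x1 = 0 := by simp only [y, hv]; field_simp; ring
    have h := hmain.trans (hmin' t ⟨hst.le, le_rfl⟩ x1 (by rw [hy1, abs_zero]; exact hη.le))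
    have h' := (mul_nonneg_iff_of_pos_left (Real.exp_pos _)).1 h
    have hw : 0 < w t x1 := by
      have e : w t x1 = E t * (η ^ 2) ^ 2 := by simp only [w, q, hy1]; ring
      rw [e]
      exact mul_pos (hE t) (by positivity)
    linarith
  -- A negative minimum lies neither on the lateral edge, where `w = 0 ≤ u`, nor at the initial
  -- time, where `w ≤ l ≤ u`. There the first- and second-order conditions in `x` and the one-sided
  -- condition in time apply. With `d = u - w < 0` they yield `d ≤ ∂_t d ≤ 2d`, which is absurd.
  by_contra! hneg
  have hd : u r x - w r x < 0 := by
    by_contra! h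
    exact hneg.not_ge (mul_nonneg (Real.exp_pos _).le h)
  have hq_le : ∀ r x, |y r x| ≤ η → 0 ≤ q r x := fun r x h => by
    have := sq_le_sq' (abs_le.1 h).1 (abs_le.1 h).2
    simp only [q]; linarith
  have hyη : |y r x| < η := by
    rw [hyz]
    refine lt_of_le_of_ne (abs_le.2 hz) fun h => ?_
    have : w r x = 0 := by
      simp only [w, q, hyz]; rw [← sq_abs z, h]; ring
    linarith [hu0 r hr x]
  have hsr : s < r := by
    refine lt_of_le_of_ne hr.1 fun h => ?_
    subst h
    have hys : y s x = x - x0 := by simp only [y]; ring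
    have h1 := hηu x (hys ▸ hyη.le)
    have h2 : w s x ≤ l := by
      have hq0 := hq_le s x hyη.le
      have hq1 : q s x ≤ 1 := by simp only [q]; nlinarith [sq_nonneg (y s x)]
      have : q s x ^ 2 ≤ 1 := pow_le_one₀ hq0 hq1
      simp only [w, E, sub_self, mul_zero, Real.exp_zero, mul_one]
      exact mul_le_of_le_one_right hl0.le this
    linarith
  have hfx : ∀ x', HasDerivAt (fun x' => u r x' - w r x') (u1 r x' - w1 r x') x' := fun x' =>
    (hu r hr x').fun_sub (hwx r x')
  have hloc : IsLocalMin (fun x' => u r x' - w r x') x := by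
    have : ∀ᶠ x' in nhds x, |y r x'| < η :=
      (hyx r x).continuousAt.abs.eventually (gt_mem_nhds hyη)
    filter_upwards [this] with x' hx'
    exact le_of_mul_le_mul_left (hmin' r hr x' hx'.le) (Real.exp_pos _)
  have hgrad : u1 r x - w1 r x = 0 := hloc.hasDerivAt_eq_zero (hfx x)
  have hlap := second_deriv_nonneg_of_isLocalMin hfx ((hu1 r hr x).fun_sub (hwxx r x)) hloc
  have htime := nonpos_of_hasDerivAt_of_left_min (g := fun r => Z r x)
    ((hexp (-2) r).fun_mul ((hut r hr x).fun_sub (hwt r x))) (by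
      have h1 : ∀ᶠ r' in nhds r, |y r' x| < η :=
        (hyt r x).continuousAt.abs.eventually (gt_mem_nhds hyη)
      filter_upwards [nhdsWithin_le_nhds h1, nhdsWithin_le_nhds (Ioi_mem_nhds hsr),
        self_mem_nhdsWithin] with r' h1 h2 h3
      exact hmin' r' ⟨le_of_lt h2, (le_of_lt h3).trans hr.2⟩ x h1.le)
  have htime' : ut r x - E r * (-K * q r x ^ 2 + 4 * v * q r x * y r x) ≤ 2 * (u r x - w r x) := by
    have := Real.exp_pos (-2 * (r - s))
    nlinarith
  have hbar := mul_le_mul_of_nonneg_left (barrier_inequality (y := y r x) hη hη1 hK rfl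
    (hq_le r x hyη.le) (hb r x) (hb1 r x)) (hE r).le
  have hb1' : -(u r x - w r x) * b1 r x ≥ (u r x - w r x) := by
    have := (abs_le.1 (hb1 r x)).1
    nlinarith
  have hw1 : u1 r x = w1 r x := by linarith
  have hh := heq r hr x
  rw [hw1] at hh
  have e1 : w1 r x = E r * (2 * q r x * (-2 * y r x)) := rfl
  have e2 : w r x = E r * q r x ^ 2 := rfl
  rw [e1] at hh
  have e3 : E r * (8 * y r x ^ 2 - 4 * q r x + 4 * b r x * q r x * y r x - b1 r x * q r x ^ 2) =
    E r * (8 * y r x ^ 2 - 4 * q r x) - b r x * (E r * (2 * q r x * (-2 * y r x))) -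
      b1 r x * w r x := by rw [e2]; ring
  rw [e3] at hbar
  linarith

theorem IsWeakSolution.density_pos (hρ : IsWeakSolution ρ)
    (h0 : flux (ρ 0) ≠ 0) {t : ℝ} (ht : 0 < t) (θ : ℝ) : 0 < density ρ 0 t θ := by
  obtain ⟨x0, hx0⟩ : ∃ x0, 0 < density ρ 0 (t / 2) x0 := by
    by_contra! h
    have h1 := hρ.integral_density h0 (half_pos ht)
    have h2 : ∀ θ, density ρ 0 (t / 2) θ = 0 := fun θ =>
      le_antisymm (h θ) (hρ.density_nonneg h0 (half_pos ht) θ)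
    simp [h2] at h1
  have hp : ∀ r ∈ Icc (t / 2) t, 0 < r := fun r hr => (half_pos ht).trans_le hr.1
  exact pos_of_nonneg_of_parabolic (half_lt_self ht)
    (b := fun r => drift (direction (ρ r))) (b1 := fun r => driftDeriv (direction (ρ r)))
    ((hρ.continuousOn_density h0 0).mono fun p hp' => ⟨hp _ hp'.1, mem_univ _⟩)
    (fun r hr x => hρ.density_nonneg h0 (hp r hr) x)
    (fun r hr x => hρ.hasDerivAt_density h0 0 (hp r hr) x)
    (fun r hr x => hρ.hasDerivAt_density h0 1 (hp r hr) x)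
    (fun r hr x => hρ.hasDerivAt_density_time h0 0 (hp r hr) x)
    (fun r hr x => hρ.densityRate_zero h0 (hp r hr) x)
    (fun r x => (abs_drift_le _ x).trans (norm_direction_le _))
    (fun r x => (abs_driftDeriv_le _ x).trans (norm_direction_le _)) hx0

/-! ### The relative Fisher information -/

theorem vonMises_exp (v : ℂ) : ∃ c : ℝ, 0 < c ∧ ∀ θ : ℝ,
    vonMises v (Circle.exp θ) = c * Real.exp (v.re * Real.cos θ + v.im * Real.sin θ) := by
  have hc : Continuous fun η : Circle => Real.exp ⟪(η : ℂ), v⟫_ℝ :=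
    (continuous_coe_circle.inner continuous_const).rexp
  refine ⟨(∫ η : Circle, Real.exp ⟪(η : ℂ), v⟫_ℝ ∂arcLength)⁻¹, inv_pos.2 ?_, fun θ => by
    rw [vonMises, inner_exp]⟩
  rw [integral_arcLength hc.stronglyMeasurable]
  exact intervalIntegral.intervalIntegral_pos_of_pos
    ((hc.comp Circle.exp.continuous).intervalIntegrable _ _) (fun _ => Real.exp_pos _)
    (by linarith [Real.pi_pos])

theorem hasDerivAt_potential (v : ℂ) (θ : ℝ) :
    HasDerivAt (fun θ => v.re * Real.cos θ + v.im * Real.sin θ) (drift v θ) θ :=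
  (((Real.hasDerivAt_cos θ).const_mul _).fun_add ((Real.hasDerivAt_sin θ).const_mul _)).congr_deriv
    (by rw [drift]; ring)

theorem norm_grad_sq (f : Circle → ℝ) (ω : Circle) : ‖grad f ω‖ ^ 2 = arcDeriv f ω ^ 2 := by
  rw [grad, norm_smul, norm_mul, Complex.norm_I, Circle.norm_coe, mul_one, mul_one,
    Real.norm_eq_abs, sq_abs]

/-- The normalising constant drops out of the logarithmic derivative, and the potential `ω · v` has
angular derivative `drift v`. -/
theorem fisherInfo_ofLift_vonMises {F F1 : ℝ → ℝ} (v : ℂ) (hF : Function.Periodic F (2 * π))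
    (hpos : ∀ θ, 0 < F θ) (hd : ∀ θ, HasDerivAt F (F1 θ) θ) (hF1 : Continuous F1) :
    fisherInfo (ofLift F) (vonMises v) =
      ∫ θ in (-π)..π, (F1 θ - drift v θ * F θ) ^ 2 / F θ := by
  have hFc : Continuous F := continuous_iff_continuousAt.2 fun θ => (hd θ).continuousAt
  have hb : Continuous (drift v) :=
    continuous_iff_continuousAt.2 fun θ => (hasDerivAt_drift v θ).continuousAt
  have hHc : Continuous fun θ => (F1 θ - drift v θ * F θ) ^ 2 / F θ :=
    ((hF1.sub (hb.mul hFc)).pow 2).div hFc fun θ => (hpos θ).ne'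
  obtain ⟨c, hc, hM⟩ := vonMises_exp v
  have key : ∀ θ, ‖grad (fun η => Real.log (ofLift F η / vonMises v η)) (Circle.exp θ)‖ ^ 2 *
      ofLift F (Circle.exp θ) = (F1 θ - drift v θ * F θ) ^ 2 / F θ := fun θ => by
    rw [norm_grad_sq, arcDeriv_exp]
    simp_rw [ofLift_exp hF, hM]
    have e : (fun φ => Real.log (F φ / (c * Real.exp (v.re * Real.cos φ + v.im * Real.sin φ)))) =
        fun φ => Real.log (F φ) - (Real.log c + (v.re * Real.cos φ + v.im * Real.sin φ)) := by
      funext φ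
      rw [Real.log_div (hpos φ).ne' (mul_pos hc (Real.exp_pos _)).ne',
        Real.log_mul hc.ne' (Real.exp_pos _).ne', Real.log_exp]
    have hder := ((hd θ).log (hpos θ).ne').fun_sub ((hasDerivAt_potential v θ).const_add (Real.log c))
    rw [e, hder.deriv]
    have := (hpos θ).ne'
    field_simp
  have hper : Function.Periodic (fun θ => (F1 θ - drift v θ * F θ) ^ 2 / F θ) (2 * π) := fun θ => by
    simp only
    rw [← key, ← key, Circle.exp_add_two_pi]
  have hfun : (fun ω => ‖grad (fun η => Real.log (ofLift F η / vonMises v η)) ω‖ ^ 2 * ofLift F ω) =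
      ofLift fun θ => (F1 θ - drift v θ * F θ) ^ 2 / F θ := by
    funext ω
    obtain ⟨θ, rfl⟩ := exists_exp_eq ω
    rw [key, ofLift_exp hper]
  rw [fisherInfo, hfun, integral_arcLength (measurable_ofLift hHc).stronglyMeasurable]
  simp_rw [ofLift_exp hper]

/-- The time derivative of the direction of the flux. -/
def directionRate (μ : ProbabilityMeasure Circle) : ℂ :=
  ‖flux μ‖⁻¹ • momentRate μ 1 - (⟪flux μ, momentRate μ 1⟫_ℝ / ‖flux μ‖ ^ 3) • flux μ

/-- `Ω'` is `J' / |J|` minus its component along `J`; pairing that component with `J'` gives a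
nonnegative square, which is discarded. -/
theorem inner_directionRate_le {μ : ProbabilityMeasure Circle} :
    ⟪directionRate μ, momentRate μ 1⟫_ℝ ≤ ‖momentRate μ 1‖ ^ 2 / ‖flux μ‖ := by
  rw [directionRate, inner_sub_left, real_inner_smul_left, real_inner_smul_left,
    real_inner_self_eq_norm_sq]
  have : 0 ≤ ⟪flux μ, momentRate μ 1⟫_ℝ / ‖flux μ‖ ^ 3 * ⟪flux μ, momentRate μ 1⟫_ℝ := by
    rw [div_mul_eq_mul_div]
    exact div_nonneg (mul_self_nonneg _) (by positivity)
  rw [div_eq_inv_mul (‖momentRate μ 1‖ ^ 2)]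
  linarith

theorem continuous_drift : Continuous fun p : ℂ × ℝ => drift p.1 p.2 := by
  unfold drift; fun_prop

/-- The probability current `∂_θ f - b f`. -/
def current (ρ : ℝ → ProbabilityMeasure Circle) (t θ : ℝ) : ℝ :=
  density ρ 1 t θ - drift (direction (ρ t)) θ * density ρ 0 t θ

/-- The time derivative of the probability current. -/
def currentRate (ρ : ℝ → ProbabilityMeasure Circle) (t θ : ℝ) : ℝ :=
  densityRate ρ 1 t θ - (drift (directionRate (ρ t)) θ * density ρ 0 t θ +
    drift (direction (ρ t)) θ * densityRate ρ 0 t θ)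

/-- The relative Fisher information with respect to the local equilibrium. -/
def fisher (ρ : ℝ → ProbabilityMeasure Circle) (t : ℝ) : ℝ :=
  ∫ θ in (-π)..π, current ρ t θ ^ 2 / density ρ 0 t θ

/-- The time derivative of the density of the Fisher information. -/
def fisherRate (ρ : ℝ → ProbabilityMeasure Circle) (t θ : ℝ) : ℝ :=
  2 * current ρ t θ * currentRate ρ t θ / density ρ 0 t θ -
    current ρ t θ ^ 2 * densityRate ρ 0 t θ / density ρ 0 t θ ^ 2

theorem periodic_drift (v : ℂ) : Function.Periodic (drift v) (2 * π) := fun θ => by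
  simp only [drift, Real.sin_add_two_pi, Real.cos_add_two_pi]

theorem periodic_densityRate (j : ℕ) (t : ℝ) :
    Function.Periodic (densityRate ρ j t) (2 * π) := fun θ => by
  simp only [densityRate, fourierSum, fourierTerm, Circle.exp_add_two_pi]

theorem periodic_current (t : ℝ) : Function.Periodic (current ρ t) (2 * π) := fun θ => by
  simp only [current, periodic_density _ _ θ, periodic_drift _ θ]

theorem integral_deriv_eq_zero {F F' : ℝ → ℝ} (hF : Function.Periodic F (2 * π))
    (hd : ∀ θ, HasDerivAt F (F' θ) θ) (hc : Continuous F') : ∫ θ in (-π)..π, F' θ = 0 := by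
  rw [intervalIntegral.integral_eq_sub_of_hasDerivAt (fun θ _ => hd θ) (hc.intervalIntegrable _ _)]
  have := hF (-π)
  rw [show -π + 2 * π = π by ring] at this
  rw [this, sub_self]

namespace IsWeakSolution

variable (hρ : IsWeakSolution ρ) (h0 : flux (ρ 0) ≠ 0)
include hρ h0

theorem hasDerivAt_direction {t : ℝ} (ht : 0 < t) :
    HasDerivAt (fun t => direction (ρ t)) (directionRate (ρ t)) t := by
  have hJ := hρ.flux_ne_zero h0 ht.le
  have hn : ‖flux (ρ t)‖ ≠ 0 := norm_ne_zero_iff.2 hJ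
  have h1 := hρ.hasDerivAt_moment h0 1 ht
  simp_rw [moment_one] at h1
  have h2 := (h1.norm_sq.sqrt (pow_ne_zero 2 hn))
  simp_rw [Real.sqrt_sq (norm_nonneg _)] at h2
  refine ((h2.fun_inv hn).fun_smul h1).congr_deriv ?_
  rw [directionRate, sub_eq_add_neg, ← neg_smul]
  congr 2
  field_simp

theorem continuousOn_directionRate : ContinuousOn (fun t => directionRate (ρ t)) (Ioi 0) := by
  have hJ := (hρ.continuousOn_flux).mono (Ioi_subset_Ici_self (a := (0 : ℝ)))
  have hD := (hρ.continuousOn_momentRate h0 1).mono (Ioi_subset_Ici_self (a := (0 : ℝ)))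
  have hn : ∀ t ∈ Ioi (0 : ℝ), ‖flux (ρ t)‖ ≠ 0 := fun t ht =>
    norm_ne_zero_iff.2 (hρ.flux_ne_zero h0 (le_of_lt ht))
  exact ((hJ.norm.inv₀ hn).smul hD).sub
    (((hJ.inner hD).div (hJ.norm.pow 3) fun t ht => pow_ne_zero 3 (hn t ht)).smul hJ)

theorem hasDerivAt_drift_direction {t : ℝ} (ht : 0 < t) (θ : ℝ) :
    HasDerivAt (fun t => drift (direction (ρ t)) θ) (drift (directionRate (ρ t)) θ) t := by
  have h := hρ.hasDerivAt_direction h0 ht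
  have hre := Complex.reCLM.hasFDerivAt.comp_hasDerivAt t h
  have him := Complex.imCLM.hasFDerivAt.comp_hasDerivAt t h
  exact (hre.fun_neg.mul_const _).fun_add (him.mul_const _)

/-- The equation in divergence form, `∂_t u = ∂_θ G`. -/
theorem hasDerivAt_current {t : ℝ} (ht : 0 < t) (θ : ℝ) :
    HasDerivAt (current ρ t) (densityRate ρ 0 t θ) θ :=
  ((hρ.hasDerivAt_density h0 1 ht θ).fun_sub ((hasDerivAt_drift _ θ).fun_mul
    (hρ.hasDerivAt_density h0 0 ht θ))).congr_deriv (by rw [hρ.densityRate_zero h0 ht]; ring)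

theorem hasDerivAt_current_time {t : ℝ} (ht : 0 < t) (θ : ℝ) :
    HasDerivAt (fun t => current ρ t θ) (currentRate ρ t θ) t :=
  (hρ.hasDerivAt_density_time h0 1 ht θ).fun_sub ((hρ.hasDerivAt_drift_direction h0 ht θ).fun_mul
    (hρ.hasDerivAt_density_time h0 0 ht θ))

theorem hasDerivAt_fisher_integrand {t : ℝ} (ht : 0 < t) (θ : ℝ) :
    HasDerivAt (fun t => current ρ t θ ^ 2 / density ρ 0 t θ) (fisherRate ρ t θ) t := by
  have hU := (hρ.density_pos h0 ht θ).ne'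
  refine (((hρ.hasDerivAt_current_time h0 ht θ).fun_pow 2).fun_div
    (hρ.hasDerivAt_density_time h0 0 ht θ) hU).congr_deriv ?_
  rw [fisherRate]
  push_cast
  field_simp

theorem continuousOn_drift_direction :
    ContinuousOn (fun p : ℝ × ℝ => drift (direction (ρ p.1)) p.2) (Ioi 0 ×ˢ univ) := by
  have h := ((hρ.continuousOn_direction h0).mono Ioi_subset_Ici_self).comp
    (continuousOn_fst (s := Ioi (0 : ℝ) ×ˢ (univ : Set ℝ))) fun p hp => hp.1
  exact continuous_drift.comp_continuousOn (h.prodMk continuousOn_snd)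

theorem continuousOn_current :
    ContinuousOn (fun p : ℝ × ℝ => current ρ p.1 p.2) (Ioi 0 ×ˢ univ) :=
  (hρ.continuousOn_density h0 1).sub
    ((hρ.continuousOn_drift_direction h0).mul (hρ.continuousOn_density h0 0))

theorem continuousOn_currentRate :
    ContinuousOn (fun p : ℝ × ℝ => currentRate ρ p.1 p.2) (Ioi 0 ×ˢ univ) := by
  have h := (hρ.continuousOn_directionRate h0).comp
    (continuousOn_fst (s := Ioi (0 : ℝ) ×ˢ (univ : Set ℝ))) fun p hp => hp.1
  exact (hρ.continuousOn_densityRate h0 1).sub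
    (((continuous_drift.comp_continuousOn (h.prodMk continuousOn_snd)).mul
      (hρ.continuousOn_density h0 0)).add
    ((hρ.continuousOn_drift_direction h0).mul (hρ.continuousOn_densityRate h0 0)))

theorem continuousOn_fisherRate :
    ContinuousOn (fun p : ℝ × ℝ => fisherRate ρ p.1 p.2) (Ioi 0 ×ˢ univ) := by
  have hne : ∀ p ∈ Ioi (0 : ℝ) ×ˢ (univ : Set ℝ), density ρ 0 p.1 p.2 ≠ 0 := fun p hp =>
    (hρ.density_pos h0 hp.1 p.2).ne'
  have hG := hρ.continuousOn_current h0
  have hU := hρ.continuousOn_density h0 0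
  exact (((continuousOn_const.mul hG).mul (hρ.continuousOn_currentRate h0)).div hU hne).sub
    (((hG.pow 2).mul (hρ.continuousOn_densityRate h0 0)).div (hU.pow 2)
      fun p hp => pow_ne_zero 2 (hne p hp))

omit hρ h0 in
theorem continuous_slice {f : ℝ → ℝ → ℝ}
    (hf : ContinuousOn (fun p : ℝ × ℝ => f p.1 p.2) (Ioi 0 ×ˢ univ)) {t : ℝ} (ht : 0 < t) :
    Continuous (f t) := by
  rw [← continuousOn_univ]
  exact hf.comp (by fun_prop : ContinuousOn (fun θ : ℝ => (t, θ)) univ) fun θ _ => ⟨ht, mem_univ _⟩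

theorem continuous_fisher_integrand {t : ℝ} (ht : 0 < t) :
    Continuous fun θ => current ρ t θ ^ 2 / density ρ 0 t θ :=
  ((continuous_slice (hρ.continuousOn_current h0) ht).pow 2).div (hρ.continuous_density h0 0 ht)
    fun θ => (hρ.density_pos h0 ht θ).ne'

theorem hasDerivAt_fisher {t : ℝ} (ht : 0 < t) :
    HasDerivAt (fisher ρ) (∫ θ in (-π)..π, fisherRate ρ t θ) t := by
  have hsub : Icc (t / 2) (2 * t) ×ˢ Icc (-π) π ⊆ Ioi (0 : ℝ) ×ˢ univ := fun p hp =>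
    ⟨(half_pos ht).trans_le hp.1.1, mem_univ _⟩
  obtain ⟨C, hC⟩ := (isCompact_Icc.prod isCompact_Icc).exists_bound_of_continuousOn
    ((hρ.continuousOn_fisherRate h0).mono hsub)
  have hpi : -π ≤ π := by linarith [Real.pi_pos]
  have hmem : ∀ r ∈ Icc (t / 2) (2 * t), 0 < r := fun r hr => (half_pos ht).trans_le hr.1
  refine (intervalIntegral.hasDerivAt_integral_of_dominated_loc_of_deriv_le
    (s := Icc (t / 2) (2 * t)) (bound := fun _ => C)
    (Icc_mem_nhds (half_lt_self ht) (by linarith)) ?_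
    ((hρ.continuous_fisher_integrand h0 ht).intervalIntegrable _ _)
    (continuous_slice (hρ.continuousOn_fisherRate h0) ht).aestronglyMeasurable
    (.of_forall fun θ hθ r hr => ?_) (by simp)
    (.of_forall fun θ _ r hr => hρ.hasDerivAt_fisher_integrand h0 (hmem r hr) θ)).2
  · filter_upwards [Ioi_mem_nhds ht] with r hr
    exact (hρ.continuous_fisher_integrand h0 hr).aestronglyMeasurable
  · rw [uIoc_of_le hpi] at hθ
    exact hC (r, θ) ⟨hr, Ioc_subset_Icc_self hθ⟩

/-- `drift v` is the angular derivative of `ω · v`, so integrating by parts against `∂_t u = ∂_θ G`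
gives minus the time derivative of `⟪v, J⟫`. -/
theorem integral_drift_mul_current {t : ℝ} (ht : 0 < t) (v : ℂ) :
    ∫ θ in (-π)..π, drift v θ * current ρ t θ = -⟪v, momentRate (ρ t) 1⟫_ℝ := by
  have hgen : ∀ θ : ℝ, ⟪v, generatorZpow (direction (ρ t)) 1 (Circle.exp θ)⟫_ℝ =
      driftDeriv v θ + drift v θ * drift (direction (ρ t)) θ := fun θ => by
    have h := generator_clm_zpow (innerSL ℝ v) (direction (ρ t)) 1 (Circle.exp θ)
    have e : ∀ φ : ℝ, innerSL ℝ v ((Circle.exp φ : ℂ) ^ (1 : ℤ)) =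
        v.re * Real.cos φ + v.im * Real.sin φ := fun φ => by
      rw [zpow_one, innerSL_apply_apply, real_inner_comm, inner_exp]
    rw [laplacian_exp, inner_projPerp_grad, arcDeriv_exp] at h
    simp_rw [e] at h
    rw [funext fun φ => (hasDerivAt_potential v φ).deriv, (hasDerivAt_drift v θ).deriv,
      inner_I_mul_exp] at h
    exact h.symm
  have hcg : Continuous (generatorZpow (direction (ρ t)) 1) := by
    unfold generatorZpow
    exact (continuous_const.mul (continuous_coe_zpow _)).add (continuous_const.mul
      ((continuous_const.mul (continuous_coe_zpow _)).sub
        (continuous_const.mul (continuous_coe_zpow _))))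
  have hD : ⟪v, momentRate (ρ t) 1⟫_ℝ = ∫ θ in (-π)..π,
      (driftDeriv v θ + drift v θ * drift (direction (ρ t)) θ) * density ρ 0 t θ := by
    rw [← integral_generatorZpow]
    refine ((innerSL ℝ v).integral_comp_comm (integrable_of_continuous _ hcg)).symm.trans ?_
    refine (hρ.integral_eq_density h0 ht ((innerSL ℝ v).continuous.comp hcg)).trans ?_
    exact intervalIntegral.integral_congr fun θ _ => congrArg (· * density ρ 0 t θ) (hgen θ)
  have hc : ∀ v, Continuous (drift v) := fun v =>
    continuous_iff_continuousAt.2 fun θ => (hasDerivAt_drift v θ).continuousAt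
  have hc' : Continuous (driftDeriv v) :=
    continuous_iff_continuousAt.2 fun θ => (hasDerivAt_driftDeriv v θ).continuousAt
  have hU := fun j => hρ.continuous_density h0 j ht
  have hG := continuous_slice (hρ.continuousOn_current h0) ht
  have hc1 : Continuous fun θ => drift v θ * current ρ t θ := (hc v).mul hG
  have hc2 : Continuous fun θ =>
      (driftDeriv v θ + drift v θ * drift (direction (ρ t)) θ) * density ρ 0 t θ :=
    (hc'.add ((hc v).mul (hc _))).mul (hU 0)
  rw [hD, eq_neg_iff_add_eq_zero, ← intervalIntegral.integral_add
    (hc1.intervalIntegrable _ _) (hc2.intervalIntegrable _ _)]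
  rw [← integral_deriv_eq_zero (F := fun θ => drift v θ * density ρ 0 t θ)
    (F' := fun θ => driftDeriv v θ * density ρ 0 t θ + drift v θ * density ρ 1 t θ)
    (fun θ => by simp only [periodic_density _ _ θ, periodic_drift _ θ])
    (fun θ => (hasDerivAt_drift v θ).fun_mul (hρ.hasDerivAt_density h0 0 ht θ))
    ((hc'.mul (hU 0)).add ((hc v).mul (hU 1)))]
  refine intervalIntegral.integral_congr fun θ _ => ?_
  simp only [current]
  ring

/-- Choosing `v = J'` in the previous identity gives `|J'|² = -∫ drift(J') G`. Young's inequality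
with weight `u`, of total mass `1`, bounds this by `|J'|²/2 + I/2`. -/
theorem norm_momentRate_sq_le_fisher {t : ℝ} (ht : 0 < t) :
    ‖momentRate (ρ t) 1‖ ^ 2 ≤ fisher ρ t := by
  set D := momentRate (ρ t) 1
  have h1 := hρ.integral_drift_mul_current h0 ht D
  rw [real_inner_self_eq_norm_sq] at h1
  have hc : Continuous (drift D) :=
    continuous_iff_continuousAt.2 fun θ => (hasDerivAt_drift D θ).continuousAt
  have hU := hρ.continuous_density h0 0 ht
  have hG := continuous_slice (hρ.continuousOn_current h0) ht
  have hI := hρ.continuous_fisher_integrand h0 ht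
  have hpi : -π ≤ π := by linarith [Real.pi_pos]
  have h2 : ∫ θ in (-π)..π, -(drift D θ * current ρ t θ) ≤ ∫ θ in (-π)..π,
      (1 / 2 * ‖D‖ ^ 2 * density ρ 0 t θ + 1 / 2 * (current ρ t θ ^ 2 / density ρ 0 t θ)) := by
    refine intervalIntegral.integral_mono_on hpi ((hc.mul hG).neg.intervalIntegrable _ _)
      (((continuous_const.mul hU).add (continuous_const.mul hI)).intervalIntegrable _ _)
      fun θ _ => ?_
    have hp := hρ.density_pos h0 ht θ
    have hdD : drift D θ ^ 2 ≤ ‖D‖ ^ 2 := by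
      rw [← sq_abs (drift D θ)]
      exact pow_le_pow_left₀ (abs_nonneg _) (abs_drift_le D θ) 2
    have hsq : 0 ≤ (drift D θ * density ρ 0 t θ + current ρ t θ) ^ 2 / density ρ 0 t θ := by
      positivity
    have e : (drift D θ * density ρ 0 t θ + current ρ t θ) ^ 2 / density ρ 0 t θ =
        drift D θ ^ 2 * density ρ 0 t θ + 2 * (drift D θ * current ρ t θ) +
          current ρ t θ ^ 2 / density ρ 0 t θ := by field_simp; ring
    have := mul_le_mul_of_nonneg_right hdD hp.le
    linarith
  have hc1 : Continuous fun θ => 1 / 2 * ‖D‖ ^ 2 * density ρ 0 t θ := continuous_const.mul hU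
  have hc2 : Continuous fun θ => 1 / 2 * (current ρ t θ ^ 2 / density ρ 0 t θ) :=
    continuous_const.mul hI
  rw [intervalIntegral.integral_neg, h1, intervalIntegral.integral_add
    (hc1.intervalIntegrable _ _) (hc2.intervalIntegrable _ _), intervalIntegral.integral_const_mul,
    intervalIntegral.integral_const_mul, hρ.integral_density h0 ht] at h2
  change _ ≤ _ + 1 / 2 * fisher ρ t at h2
  linarith

/-- The entropy-dissipation computation: up to an exact derivative, the rate is a nonpositive
dissipation, a curvature term bounded by `2 I`, and the contribution `2 ⟪Ω', J'⟫` of the moving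
equilibrium. -/
theorem integral_fisherRate_le {t : ℝ} (ht : 0 < t) :
    ∫ θ in (-π)..π, fisherRate ρ t θ ≤ (2 + 2 / ‖flux (ρ t)‖) * fisher ρ t := by
  set Ω := direction (ρ t) with hΩ
  set Ω' := directionRate (ρ t) with hΩ'
  have hpos := hρ.density_pos h0 ht
  have hpi : -π ≤ π := by linarith [Real.pi_pos]
  have hcb : ∀ v, Continuous (drift v) := fun v =>
    continuous_iff_continuousAt.2 fun θ => (hasDerivAt_drift v θ).continuousAt
  have hcb' : Continuous (driftDeriv Ω) :=
    continuous_iff_continuousAt.2 fun θ => (hasDerivAt_driftDeriv Ω θ).continuousAt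
  have hU := fun j => hρ.continuous_density h0 j ht
  have hV := fun j => continuous_slice (hρ.continuousOn_densityRate h0 j) ht
  have hG := continuous_slice (hρ.continuousOn_current h0) ht
  have hI := hρ.continuous_fisher_integrand h0 ht
  have hF := continuous_slice (hρ.continuousOn_fisherRate h0) ht
  -- With `p = G / u`, this is `u ∂_θ(p²) + p² G`, rewritten through `∂_θ G = ∂_t u`; it collects
  -- all the integrations by parts.
  let B : ℝ → ℝ := fun θ => 2 * (current ρ t θ * densityRate ρ 0 t θ / density ρ 0 t θ) -
    current ρ t θ ^ 3 / density ρ 0 t θ ^ 2 -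
      2 * (drift Ω θ * (current ρ t θ ^ 2 / density ρ 0 t θ))
  -- The squared bracket is `∂_θ p`, so the terms added to `fisherRate` are the dissipation `2u(∂_θ
  -- p)²`, the curvature term and the rotation term, each with its sign reversed.
  let B' : ℝ → ℝ := fun θ => fisherRate ρ t θ +
    2 * (densityRate ρ 0 t θ / density ρ 0 t θ -
      current ρ t θ * density ρ 1 t θ / density ρ 0 t θ ^ 2) ^ 2 * density ρ 0 t θ -
    2 * (driftDeriv Ω θ * (current ρ t θ ^ 2 / density ρ 0 t θ)) +
    2 * (drift Ω' θ * current ρ t θ)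
  have hB : ∀ θ, HasDerivAt B (B' θ) θ := fun θ => by
    have hu := (hpos θ).ne'
    have d0 := hρ.hasDerivAt_density h0 0 ht θ
    have dG := hρ.hasDerivAt_current h0 ht θ
    have dV := hρ.hasDerivAt_densityRate h0 0 ht θ
    have db := hasDerivAt_drift Ω θ
    refine (((((dG.fun_mul dV).fun_div d0 hu).const_mul 2).fun_sub
      ((dG.fun_pow 3).fun_div (d0.fun_pow 2) (pow_ne_zero 2 hu))).fun_sub
      ((db.fun_mul ((dG.fun_pow 2).fun_div d0 hu)).const_mul 2)).congr_deriv ?_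
    have hU1 : density ρ 1 t θ = current ρ t θ + drift Ω θ * density ρ 0 t θ := by
      rw [current]; ring
    simp only [B', fisherRate, currentRate, ← hΩ, ← hΩ', zero_add, hU1]
    push_cast
    field_simp
    ring
  have hB'c : Continuous B' := by
    have hne : ∀ θ, density ρ 0 t θ ≠ 0 := fun θ => (hpos θ).ne'
    exact ((hF.add ((continuous_const.mul ((((hV 0).div (hU 0) hne).sub
      ((hG.mul (hU 1)).div ((hU 0).pow 2) fun θ => pow_ne_zero 2 (hne θ))).pow 2)).mul (hU 0))).sub
      (continuous_const.mul (hcb'.mul hI))).add (continuous_const.mul ((hcb Ω').mul hG))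
  have hBper : Function.Periodic B (2 * π) := fun θ => by
    simp only [B, periodic_current _ θ, periodic_densityRate _ _ θ, periodic_density _ _ θ,
      periodic_drift _ θ]
  have hB0 := integral_deriv_eq_zero hBper hB hB'c
  have hle : ∫ θ in (-π)..π, fisherRate ρ t θ ≤ ∫ θ in (-π)..π,
      (B' θ + (2 * (current ρ t θ ^ 2 / density ρ 0 t θ) + -2 * (drift Ω' θ * current ρ t θ))) := by
    refine intervalIntegral.integral_mono_on hpi (hF.intervalIntegrable _ _)
      ((hB'c.add ((continuous_const.mul hI).add
        (continuous_const.mul ((hcb Ω').mul hG)))).intervalIntegrable _ _) fun θ _ => ?_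
    have hp := hpos θ
    have h1 : 0 ≤ (densityRate ρ 0 t θ / density ρ 0 t θ -
      current ρ t θ * density ρ 1 t θ / density ρ 0 t θ ^ 2) ^ 2 * density ρ 0 t θ := by positivity
    have h2 : driftDeriv Ω θ * (current ρ t θ ^ 2 / density ρ 0 t θ) ≤
        current ρ t θ ^ 2 / density ρ 0 t θ :=
      mul_le_of_le_one_left (by positivity)
        ((le_abs_self _).trans ((abs_driftDeriv_le Ω θ).trans (norm_direction_le _)))
    simp only [B']
    linarith
  have hc1 : Continuous fun θ => 2 * (current ρ t θ ^ 2 / density ρ 0 t θ) :=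
    continuous_const.mul hI
  have hc2 : Continuous fun θ => -2 * (drift Ω' θ * current ρ t θ) :=
    continuous_const.mul ((hcb Ω').mul hG)
  rw [intervalIntegral.integral_add (hB'c.intervalIntegrable _ _)
    ((hc1.intervalIntegrable _ _).add (hc2.intervalIntegrable _ _)),
    hB0, zero_add, intervalIntegral.integral_add (hc1.intervalIntegrable _ _)
    (hc2.intervalIntegrable _ _),
    intervalIntegral.integral_const_mul, intervalIntegral.integral_const_mul,
    hρ.integral_drift_mul_current h0 ht] at hle
  change _ ≤ 2 * fisher ρ t + _ at hle
  have h3 := (inner_directionRate_le (μ := ρ t)).trans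
    (div_le_div_of_nonneg_right (hρ.norm_momentRate_sq_le_fisher h0 ht) (norm_nonneg _))
  calc _ ≤ 2 * fisher ρ t + 2 * (fisher ρ t / ‖flux (ρ t)‖) := by linarith
    _ = _ := by ring

theorem fisher_nonneg {t : ℝ} (ht : 0 < t) : 0 ≤ fisher ρ t :=
  (sq_nonneg _).trans (hρ.norm_momentRate_sq_le_fisher h0 ht)

/-- Grönwall's argument: `I e^{-Kr}` is nonincreasing. Replacing `|J|` by its lower bound `m` in the
rate uses `I ≥ 0`. -/
theorem fisher_le_mul_exp {s t m : ℝ} (hs : 0 < s) (hst : s ≤ t) (hm : 0 < m)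
    (hle : ∀ r ∈ Icc s t, m ≤ ‖flux (ρ r)‖) :
    fisher ρ t ≤ fisher ρ s * Real.exp ((2 + 2 / m) * (t - s)) := by
  set K := 2 + 2 / m
  have hd : ∀ r ∈ Icc s t, HasDerivAt (fun r => fisher ρ r * Real.exp (-K * r))
      ((∫ θ in (-π)..π, fisherRate ρ r θ) * Real.exp (-K * r) +
        fisher ρ r * (Real.exp (-K * r) * -K)) r := fun r hr => by
    have he : HasDerivAt (fun r => Real.exp (-K * r)) (Real.exp (-K * r) * -K) r := by
      simpa using ((hasDerivAt_id r).const_mul (-K)).exp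
    exact (hρ.hasDerivAt_fisher h0 (hs.trans_le hr.1)).fun_mul he
  have hanti : AntitoneOn (fun r => fisher ρ r * Real.exp (-K * r)) (Icc s t) := by
    refine antitoneOn_of_deriv_nonpos (convex_Icc s t)
      (fun r hr => (hd r hr).continuousAt.continuousWithinAt)
      (fun r hr => (hd r (interior_subset hr)).differentiableAt.differentiableWithinAt)
      fun r hr => ?_
    have hr' := interior_subset hr
    have hr0 : 0 < r := hs.trans_le hr'.1
    rw [(hd r hr').deriv]
    have h1 := hρ.integral_fisherRate_le h0 hr0
    have h2 : (2 + 2 / ‖flux (ρ r)‖) * fisher ρ r ≤ K * fisher ρ r :=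
      mul_le_mul_of_nonneg_right
        (add_le_add le_rfl (div_le_div_of_nonneg_left zero_le_two hm (hle r hr')))
        (hρ.fisher_nonneg h0 hr0)
    have he := Real.exp_pos (-K * r)
    nlinarith
  have h := hanti ⟨le_rfl, hst⟩ ⟨hst, le_rfl⟩ hst
  simp only at h
  have e : Real.exp (K * (t - s)) = Real.exp (-K * s) * Real.exp (K * t) := by
    rw [← Real.exp_add]; congr 1; ring
  have e2 : Real.exp (-K * t) * Real.exp (K * t) = 1 := by
    rw [← Real.exp_add, neg_mul, neg_add_cancel, Real.exp_zero]
  calc fisher ρ t = fisher ρ t * Real.exp (-K * t) * Real.exp (K * t) := by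
        rw [mul_assoc, e2, mul_one]
    _ ≤ fisher ρ s * Real.exp (-K * s) * Real.exp (K * t) := by gcongr
    _ = _ := by rw [e, mul_assoc]

theorem fisherInfo_density {t : ℝ} (ht : 0 < t) :
    fisherInfo (ofLift (density ρ 0 t)) (vonMises (direction (ρ t))) = fisher ρ t :=
  fisherInfo_ofLift_vonMises _ (periodic_density 0 t) (hρ.density_pos h0 ht)
    (hρ.hasDerivAt_density h0 0 ht) (hρ.continuous_density h0 1 ht)

end IsWeakSolution

end Vicsek

end

theorem lemma3p1
    (f₀ : Circle → ℝ) (hf₀ : Measurable f₀)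
    (hf₀_pos : ∀ᵐ ω ∂Vicsek.arcLength, 0 < f₀ ω)
    (hf₀_entropy : Integrable (fun ω => f₀ ω * Real.log (f₀ ω)) Vicsek.arcLength)
    (ρ : ℝ → ProbabilityMeasure Circle)
    (hρ₀ : Vicsek.HasDensity (ρ 0) f₀)
    (hJ₀ : 0 < ‖Vicsek.flux (ρ 0)‖)
    (hρ : Vicsek.IsWeakSolution ρ) :
    ∃ u : ℝ → Circle → ℝ,
      (∀ t : ℝ, 0 < t →
        Vicsek.IsSmooth (u t) ∧ (∀ ω, 0 < u t ω) ∧ Vicsek.HasDensity (ρ t) (u t)) ∧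
      ∀ s t : ℝ, 0 < s → s ≤ t →
        ∃ m : ℝ, IsLeast ((fun r => ‖Vicsek.flux (ρ r)‖) '' Icc s t) m ∧ 0 < m ∧
          Vicsek.fisherInfo (u t) (Vicsek.vonMises (Vicsek.direction (ρ t))) ≤
            Vicsek.fisherInfo (u s) (Vicsek.vonMises (Vicsek.direction (ρ s))) *
              Real.exp ((2 + 2 / m) * (t - s)) := by
  have h0 : Vicsek.flux (ρ 0) ≠ 0 := norm_pos_iff.1 hJ₀
  refine ⟨fun t => Vicsek.ofLift (Vicsek.density ρ 0 t), fun t ht =>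
    ⟨hρ.isSmooth_density h0 ht, fun ω => hρ.density_pos h0 ht _, hρ.hasDensity_density h0 ht⟩,
    fun s t hs hst => ?_⟩
  obtain ⟨m, hm⟩ := (isCompact_Icc.image_of_continuousOn (hρ.continuousOn_flux.norm.mono
    fun r (hr : r ∈ Icc s t) => hs.le.trans hr.1)).exists_isLeast ((nonempty_Icc.2 hst).image _)
  have hpos : 0 < m := by
    obtain ⟨r, hr, rfl⟩ := hm.1
    exact norm_pos_iff.2 (hρ.flux_ne_zero h0 (hs.le.trans hr.1))
  refine ⟨m, hm, hpos, ?_⟩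
  rw [hρ.fisherInfo_density h0 (hs.trans_le hst), hρ.fisherInfo_density h0 hs]
  exact hρ.fisher_le_mul_exp h0 hs hst hpos fun r hr => hm.2 ⟨r, hr, rfl⟩
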